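/- Let $(M,g)$ be a smooth compact Riemannian manifold without boundary, of dimension $n$. For $m\ge 0$ let $S^m$ be the bundle of symmetric covariant tensors of rank $m$ (real or complex valued) and $C^\infty(S^m)$ the space of its smooth sections; put $S^{m}=0$ for $m<0$. Let $\sigma$ be the symmetrization and $\nabla$ the Levi-Civita covariant derivative, and define - $d=\sigma\nabla: C^\infty(S^m)\to C^\infty(S^{m+1})$ and $\delta: C^\infty(S^{m+1})\to C^\infty(S^{m})$, $(\delta f)_{i_1\dots i_m}=g^{pq}\nabla_{p}f_{q i_1\dots i_m}$; - $i: S^m\to S^{m+2}$, $if=\sigma(f\otimes g)$, and $j:S^{m+2}\to S^m$, $(jf)_{i_1\dots i_m}=g^{pq}f_{pqi_1\dots i_m}$ (with $j=0$ on $S^0$ and $S^1$); - $p:S^m\to S^m$, the orthogonal projection (with respect to the scalar product induced by $g$) onto the subbundle $\mathrm{Ker}^m j=\{f\in S^m: jf=0\}$ of trace-free tensors. A field $f\in C^\infty(S^m)$ is a Killing tensor field if $df=0$; its higher harmonic is $pf$. A field $f\in C^\infty(S^m)$ is potential if $f=dv$ for some $v\in C^\infty(S^{m-1})$. For every $m\ge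 0$ the following holds. 1. Let $f$ be a Killing tensor field of rank $m$. A field $h$ of rank $m$ is a Killing tensor field with $ph=pf$ if and only if $h=f+iv$ for some Killing tensor field $v$ of rank $m-2$ (that is, $h=f$ if $m<2$). 2. A field $f\in C^\infty(\mathrm{Ker}^m j)$ is the higher harmonic of some Killing tensor field of rank $m$ if and only if $pdf=0$ and $\delta f$ is potential, i.e. $\delta f=dv$ for some $v\in C^\infty(S^{m-2})$ (that is, $\delta f=0$ if $m=1$, and no condition on $\delta f$ if $m=0$). -/

import Mathlib

open Bundle Manifold
open scoped ContDiff

noncomputable section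

namespace KillingTensor

/-! ### Algebra of covariant tensors on a finite-dimensional Euclidean space `V`

The coefficient field `𝕜` is `ℝ` (real tensors) or `ℂ` (complex-valued tensors). -/

section Algebra

variable (𝕜 : Type*) [RCLike 𝕜] (m : ℕ) (V : Type*) [NormedAddCommGroup V]
  [InnerProductSpace ℝ V]

/-- Covariant tensors of rank `m` on `V`. -/
abbrev CovTensor : Type _ := ContinuousMultilinearMap ℝ (fun _ : Fin m => V) 𝕜

variable {𝕜 m V}

/-- The tensor is symmetric, i.e. belongs to `S^m`. -/
def IsSymm (f : CovTensor 𝕜 m V) : Prop :=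
  ∀ (s : Equiv.Perm (Fin m)) (v : Fin m → V), f (fun a => v (s a)) = f v

/-- The symmetrization `σ`. -/
def symmetrize (f : CovTensor 𝕜 m V) : CovTensor 𝕜 m V :=
  ((Nat.factorial m : ℝ)⁻¹) • ∑ s : Equiv.Perm (Fin m), f.domDomCongr s

/-- The product of a tensor `f` of rank `m` with the metric tensor, before symmetrization:
`(w₀, w₁, …, wₘ₊₁) ↦ ⟨w₀, w₁⟩ f(w₂, …, wₘ₊₁)`. -/
def metricMul (f : CovTensor 𝕜 m V) : CovTensor 𝕜 (m + 2) V :=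
  ContinuousLinearMap.uncurryLeft
    ((continuousMultilinearCurryLeftEquiv ℝ (fun _ : Fin (m + 1) => V)
        𝕜).symm.toContinuousLinearEquiv.toContinuousLinearMap.comp
      (((ContinuousLinearMap.smulRightL ℝ V (CovTensor 𝕜 m V)).flip f).comp (innerSL ℝ)))

theorem metricMul_apply (f : CovTensor 𝕜 m V) (w : Fin (m + 2) → V) :
    metricMul f w = (inner ℝ (w 0) (w 1) : ℝ) • f (fun a => w a.succ.succ) := rfl

/-- The operator `i : S^m → S^{m+2}` of symmetric multiplication by the metric tensor. -/
def iOp (f : CovTensor 𝕜 m V) : CovTensor 𝕜 (m + 2) V := symmetrize (metricMul f)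

variable [FiniteDimensional ℝ V]

/-- The contraction of the first two arguments with the metric,
`(v₁, …, vₘ) ↦ g^{pq} f_{pq}(v₁, …, vₘ)`, computed in an orthonormal basis.
On symmetric tensors this is the operator `j`. -/
def jOp (f : CovTensor 𝕜 (m + 2) V) : CovTensor 𝕜 m V :=
  ∑ a, (f.curryLeft (stdOrthonormalBasis ℝ V a)).curryLeft (stdOrthonormalBasis ℝ V a)

/-- The trace `jf` vanishes; there is no condition in ranks `0` and `1`. -/
def TraceZero : {m : ℕ} → CovTensor 𝕜 m V → Prop
  | 0, _ => True
  | 1, _ => True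
  | _ + 2, f => jOp f = 0

/-- The components of a tensor with respect to an orthonormal basis. -/
def components : CovTensor 𝕜 m V →ₗ[𝕜]
    EuclideanSpace 𝕜 (Fin m → Fin (Module.finrank ℝ V)) where
  toFun f := WithLp.toLp 2 fun J => f (fun a => stdOrthonormalBasis ℝ V (J a))
  map_add' f h := by ext; simp
  map_smul' c f := by ext; simp

/-- The natural scalar product of tensors: the sum over multi-indices `J` of
`conj (f_J) * h_J` in an orthonormal basis. -/
def tensorInner (f h : CovTensor 𝕜 m V) : 𝕜 := inner 𝕜 (components f) (components h)

variable (𝕜 m V) in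
/-- The space `Ker^m j` of symmetric trace-free tensors. -/
def kerJ : Submodule 𝕜 (CovTensor 𝕜 m V) where
  carrier := {f | IsSymm f ∧ TraceZero f}
  zero_mem' := by
    refine ⟨fun _ _ => rfl, ?_⟩
    match m with
    | 0 => trivial
    | 1 => trivial
    | m + 2 => exact Finset.sum_eq_zero fun _ _ => rfl
  add_mem' := by
    rintro f h ⟨hf, hf'⟩ ⟨hh, hh'⟩
    refine ⟨fun s v => by simp [hf s v, hh s v], ?_⟩
    match m with
    | 0 => trivial
    | 1 => trivial
    | m + 2 =>
      have : jOp (f + h) = jOp f + jOp h := by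
        ext v; simp [jOp, Finset.sum_add_distrib]
      change jOp (f + h) = 0
      rw [this, show jOp f = 0 from hf', show jOp h = 0 from hh', add_zero]
  smul_mem' := by
    rintro c f ⟨hf, hf'⟩
    refine ⟨fun s v => by simp [hf s v], ?_⟩
    match m with
    | 0 => trivial
    | 1 => trivial
    | m + 2 =>
      have : jOp (c • f) = c • jOp f := by
        ext v; simp [jOp, Finset.mul_sum]
      change jOp (c • f) = 0
      rw [this, show jOp f = 0 from hf']
      ext v; simp

theorem components_injective :
    Function.Injective (components : CovTensor 𝕜 m V →ₗ[𝕜] _) := by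
  intro f h hfh
  apply ContinuousMultilinearMap.toMultilinearMap_injective
  refine Module.Basis.ext_multilinear (fun _ => (stdOrthonormalBasis ℝ V).toBasis) fun J => ?_
  simpa [components] using congrArg (fun t => t J) hfh

/-- Existence and uniqueness of the orthogonal projection onto `Ker^m j`. -/
theorem existsUnique_projection (f : CovTensor 𝕜 m V) :
    ∃! t : CovTensor 𝕜 m V, t ∈ kerJ 𝕜 m V ∧ ∀ k ∈ kerJ 𝕜 m V, tensorInner k (f - t) = 0 := by
  set K := (kerJ 𝕜 m V).map components with hK
  obtain ⟨t, ht, hc⟩ := Submodule.mem_map.1 (K.starProjection_apply_mem (components f))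
  refine ⟨t, ⟨ht, fun k hk => ?_⟩, ?_⟩
  · rw [tensorInner, map_sub, hc]
    exact (K.mem_orthogonal _).1 (K.sub_starProjection_mem_orthogonal _) _
      (Submodule.mem_map_of_mem hk)
  · rintro t' ⟨ht', hort⟩
    apply components_injective
    rw [hc]
    refine (K.eq_starProjection_of_mem_of_inner_eq_zero (Submodule.mem_map_of_mem ht') ?_).symm
    rintro w hw
    obtain ⟨k, hk, rfl⟩ := Submodule.mem_map.1 hw
    rw [← map_sub, inner_eq_zero_symm]
    exact hort k hk

/-- The operator `p`: the orthogonal projection onto the space `Ker^m j` of symmetric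
trace-free tensors. -/
def pOp (f : CovTensor 𝕜 m V) : CovTensor 𝕜 m V := (existsUnique_projection f).choose

end Algebra

/-! ### Tensor fields on a Riemannian manifold -/

section Fields

variable {n : ℕ} {M : Type*} [TopologicalSpace M] [ChartedSpace (EuclideanSpace ℝ (Fin n)) M]

/-- The differential at `u` of the inverse of the preferred chart around `c`; it sends the
`k`-th basis vector of `ℝⁿ` to the coordinate vector field `∂/∂xᵏ`. -/
def coordFrame (c : M) (u : EuclideanSpace ℝ (Fin n)) :
    EuclideanSpace ℝ (Fin n) →L[ℝ] TangentSpace (𝓡 n) ((extChartAt (𝓡 n) c).symm u) :=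
  mfderiv (𝓡 n) (𝓡 n) (extChartAt (𝓡 n) c).symm u

/-- The differential at `x` of the preferred chart around `x`. -/
def chartDifferential (x : M) : TangentSpace (𝓡 n) x →L[ℝ] EuclideanSpace ℝ (Fin n) :=
  mfderiv (𝓡 n) (𝓡 n) (extChartAt (𝓡 n) x) x

variable [RiemannianBundle (fun x : M => TangentSpace (𝓡 n) x)]

/-- The components `g_{ij}` of the metric tensor in the chart around `c`. -/
def metricCoeff (c : M) (u : EuclideanSpace ℝ (Fin n)) : Matrix (Fin n) (Fin n) ℝ :=
  Matrix.of fun i j => inner ℝ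
    (coordFrame c u (EuclideanSpace.single i 1)) (coordFrame c u (EuclideanSpace.single j 1))

/-- The partial derivative `∂g_{ij}/∂xᵏ` in the chart around `c`. -/
def metricDeriv (c : M) (u : EuclideanSpace ℝ (Fin n)) (k i j : Fin n) : ℝ :=
  fderiv ℝ (fun u' => metricCoeff c u' i j) u (EuclideanSpace.single k 1)

/-- The Christoffel symbol `Γᵏ_{ij}` of the Levi-Civita connection in the chart around `c`. -/
def christoffel (c : M) (u : EuclideanSpace ℝ (Fin n)) (k i j : Fin n) : ℝ :=
  (1 / 2) * ∑ l, (metricCoeff c u)⁻¹ k l *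
    (metricDeriv c u i j l + metricDeriv c u j i l - metricDeriv c u l i j)

/-- The Christoffel symbols as a bilinear map, `(w, v) ↦ Γᵏ_{ij} wⁱ vʲ eₖ`. -/
def christoffelMap (c : M) (u : EuclideanSpace ℝ (Fin n)) :
    EuclideanSpace ℝ (Fin n) →L[ℝ] EuclideanSpace ℝ (Fin n) →L[ℝ] EuclideanSpace ℝ (Fin n) :=
  ∑ k, ∑ i, ∑ j, christoffel c u k i j •
    (EuclideanSpace.proj (𝕜 := ℝ) i).smulRight
      ((EuclideanSpace.proj (𝕜 := ℝ) j).smulRight (EuclideanSpace.single k (1 : ℝ)))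

variable (𝕜 : Type*) [RCLike 𝕜] (n M) (m : ℕ)

/-- Fields of covariant tensors of rank `m` on `M` (not necessarily smooth or symmetric). -/
abbrev TensorField : Type _ := (x : M) → CovTensor 𝕜 m (TangentSpace (𝓡 n) x)

variable {𝕜 n M m}

/-- The tensor field read in the chart around `c`: a function on (an open subset of) `ℝⁿ`
with values in the rank `m` covariant tensors on `ℝⁿ`. -/
def inChart (f : TensorField n M 𝕜 m) (c : M) (u : EuclideanSpace ℝ (Fin n)) :
    CovTensor 𝕜 m (EuclideanSpace ℝ (Fin n)) :=
  (f ((extChartAt (𝓡 n) c).symm u)).compContinuousLinearMap (fun _ => coordFrame c u)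

theorem inChart_apply (f : TensorField n M 𝕜 m) (c : M) (u : EuclideanSpace ℝ (Fin n))
    (v : Fin m → EuclideanSpace ℝ (Fin n)) :
    inChart f c u v = f ((extChartAt (𝓡 n) c).symm u) (fun a => coordFrame c u (v a)) := rfl

/-- `f` belongs to `C^∞(S^m)`: it is symmetric and its components in local coordinates are
smooth. -/
structure IsSmoothSymm (f : TensorField n M 𝕜 m) : Prop where
  symm : ∀ x, IsSymm (f x)
  smooth : ∀ c : M, ContDiffOn ℝ ∞ (inChart f c) (extChartAt (𝓡 n) c).target

/-- The covariant derivative in the chart around `c`,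
`(∇f)(w, v₁, …, vₘ) = (∂_w f)(v₁, …, vₘ) - ∑ₛ f(v₁, …, Γ(w, vₛ), …, vₘ)`. -/
def nablaInChart (f : TensorField n M 𝕜 m) (c : M) (u : EuclideanSpace ℝ (Fin n)) :
    EuclideanSpace ℝ (Fin n) →L[ℝ] CovTensor 𝕜 m (EuclideanSpace ℝ (Fin n)) :=
  fderiv ℝ (inChart f c) u -
    ∑ s : Fin m, (ContinuousLinearMap.apply ℝ _ (inChart f c u)).comp
      (((ContinuousMultilinearMap.compContinuousLinearMapContinuousMultilinear ℝ
          (fun _ : Fin m => EuclideanSpace ℝ (Fin n))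
          (fun _ : Fin m => EuclideanSpace ℝ (Fin n)) 𝕜).toContinuousLinearMap
        (fun _ => ContinuousLinearMap.id ℝ _) s).comp (christoffelMap c u))

theorem nablaInChart_apply (f : TensorField n M 𝕜 m) (c : M) (u w : EuclideanSpace ℝ (Fin n))
    (v : Fin m → EuclideanSpace ℝ (Fin n)) :
    nablaInChart f c u w v = fderiv ℝ (inChart f c) u w v -
      ∑ s, inChart f c u (Function.update v s (christoffelMap c u w (v s))) := by
  have key (s : Fin m) (L : EuclideanSpace ℝ (Fin n) →L[ℝ] EuclideanSpace ℝ (Fin n)) :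
      (fun a => Function.update (fun _ => ContinuousLinearMap.id ℝ _) s L a (v a)) =
        Function.update v s (L (v s)) := by
    funext a
    by_cases h : a = s
    · subst h; simp
    · simp [Function.update_of_ne, h]
  simp [nablaInChart, key]

/-- The covariant derivative `∇f` with respect to the Levi-Civita connection, a field of
tensors of rank `m + 1` whose first argument is the direction of differentiation. At `x` it is
computed in the chart around `x` and carried to the tangent space by the differential of the
chart. -/
def nabla (f : TensorField n M 𝕜 m) : TensorField n M 𝕜 (m + 1) := fun x =>
  (nablaInChart f x (extChartAt (𝓡 n) x x)).uncurryLeft.compContinuousLinearMap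
    (fun _ => chartDifferential x)

theorem nabla_apply (f : TensorField n M 𝕜 m) (x : M)
    (v : Fin (m + 1) → TangentSpace (𝓡 n) x) :
    nabla f x v = nablaInChart f x (extChartAt (𝓡 n) x x)
      (chartDifferential x (v 0))
      (fun a => chartDifferential x (v a.succ)) := rfl

instance (x : M) : FiniteDimensional ℝ (TangentSpace (𝓡 n) x) :=
  inferInstanceAs (FiniteDimensional ℝ (EuclideanSpace ℝ (Fin n)))

/-- The inner differentiation `d = σ∇`. -/
def dOp (f : TensorField n M 𝕜 m) : TensorField n M 𝕜 (m + 1) :=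
  fun x => symmetrize (nabla f x)

/-- The divergence `(δf)_{i₁…iₘ} = g^{pq} ∇_p f_{q i₁…iₘ}`. -/
def divergence (f : TensorField n M 𝕜 (m + 1)) : TensorField n M 𝕜 m :=
  fun x => jOp (nabla f x)

/-- Killing tensor fields: fields `f ∈ C^∞(S^m)` with `df = 0`. -/
def IsKilling (f : TensorField n M 𝕜 m) : Prop := IsSmoothSymm f ∧ dOp f = 0

/-- The higher harmonic `pf` of a tensor field. -/
def higherHarmonic (f : TensorField n M 𝕜 m) : TensorField n M 𝕜 m := fun x => pOp (f x)

/-- `f` belongs to `C^∞(Ker^m j)`. -/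
def IsSmoothTraceFree (f : TensorField n M 𝕜 m) : Prop :=
  IsSmoothSymm f ∧ ∀ x, TraceZero (f x)

/-- `f = iv` for some Killing field `v` of rank `m - 2`; a tensor field of negative rank
is zero. -/
def IsMetricTimesKilling : {m : ℕ} → TensorField n M 𝕜 m → Prop
  | 0, f => f = 0
  | 1, f => f = 0
  | m + 2, f => ∃ v : TensorField n M 𝕜 m, IsKilling v ∧ f = fun x => iOp (v x)

/-- `f` is potential: `f = dv` for some `v ∈ C^∞(S^{m-1})`; a tensor field of negative rank
is zero. -/
def IsPotential : {m : ℕ} → TensorField n M 𝕜 m → Prop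
  | 0, f => f = 0
  | m + 1, f => ∃ v : TensorField n M 𝕜 m, IsSmoothSymm v ∧ f = dOp v

/-- The divergence `δf` is potential; there is no condition for `m = 0`, where `δf` has
negative rank. -/
def HasPotentialDivergence : {m : ℕ} → TensorField n M 𝕜 m → Prop
  | 0, _ => True
  | _ + 1, f => IsPotential (divergence f)

end Fields

end KillingTensor

end

noncomputable section

namespace KillingTensor

section Algebra

variable {𝕜 : Type*} [RCLike 𝕜] {m : ℕ} {V : Type*} [NormedAddCommGroup V]
  [InnerProductSpace ℝ V]

/-! ### Symmetric tensors and their values on the diagonal -/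

/-! Fibrewise, `i` and `j` are adjoint up to symmetrization (`IsSymm.tensorInner_iOp`). Hence
symmetric tensors split orthogonally into `Ker j` and the image of `i`, and two fields have the same
higher harmonic exactly when they differ by some `iv`. In positive dimension `i` is injective on
symmetric tensors, because on the diagonal it multiplies the polynomial `F(x,…,x)` by `|x|²`. Since
the metric is parallel, `d` commutes with `i` (`IsSmoothSymm.dOp_iOp`).

The first claim follows: if `h = f + iv` and `df = 0`, then `dh = i(dv)`, which vanishes iff `dv =
0`. The field `v` is smooth because an injective linear equation with smooth coefficients has smooth
solutions (`IsSmoothSymm.of_iOp`).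

For the second claim let `f` be trace-free of rank `m + 1`. Then every `∇_X f` is trace-free, so `T
= ∇f` has trace-free slices. Viewing `j` as the Laplacian on polynomials gives `jσT = 2/(m+2) jT`
and `j i v = 2(n+2m)/((m+2)(m+1)) v` for trace-free `v`. Therefore `pdf = 0` iff `df = i(kδf)` with
`k = (m+1)/(n+2m)` (`pOp_symmetrize_eq_zero_iff`). A field `f + iv` is Killing iff `df = -i(dv)`,
that is, iff `pdf = 0` and `kδf = -dv`.

Identities for `∇` are obtained by differentiating chart identities along straight lines, with
vectors transported to first order by the Christoffel symbols (`hasDerivAt_inChart`). Dimension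
zero, where `i` kills scalars, is treated apart. -/

theorem IsSymm.curryLeft {F : CovTensor 𝕜 (m + 1) V} (hF : IsSymm F) (e : V) :
    IsSymm (F.curryLeft e) := by
  intro s v
  have h := hF (Equiv.Perm.decomposeFin.symm (0, s)) (Fin.cons e v)
  rw [ContinuousMultilinearMap.curryLeft_apply, ContinuousMultilinearMap.curryLeft_apply, ← h]
  congr 1
  funext a
  refine Fin.cases ?_ (fun a => ?_) a <;> simp

theorem IsSymm.update_const {F : CovTensor 𝕜 (m + 1) V} (hF : IsSymm F) (x e : V)
    (s : Fin (m + 1)) :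
    F (Function.update (fun _ => x) s e) = F.curryLeft e (fun _ => x) := by
  rw [ContinuousMultilinearMap.curryLeft_apply, ← hF (Equiv.swap 0 s) (Fin.cons e fun _ => x)]
  congr 1
  funext a
  rcases eq_or_ne a s with rfl | h
  · simp
  · rw [Function.update_of_ne h]
    have h0 : Equiv.swap 0 s a ≠ 0 := fun h' => h (by
      rw [← Equiv.swap_apply_left 0 s] at h'
      exact ((Equiv.swap 0 s).injective (h'.trans (by simp))))
    obtain ⟨b, hb⟩ := Fin.exists_succ_eq.2 h0
    rw [← hb, Fin.cons_succ]

theorem hasDerivAt_diag (F : CovTensor 𝕜 m V) (x e : V) (t : ℝ) :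
    HasDerivAt (fun t : ℝ => F (fun _ => x + t • e))
      (∑ s, F (Function.update (fun _ => x + t • e) s e)) t := by
  have h1 : HasDerivAt (fun t : ℝ => (fun _ : Fin m => x + t • e)) (fun _ => e) t := by
    rw [hasDerivAt_pi]
    intro _
    simpa using ((hasDerivAt_id t).smul_const e).const_add x
  have := (F.hasFDerivAt (fun _ => x + t • e)).comp_hasDerivAt t h1
  simpa [ContinuousMultilinearMap.linearDeriv_apply] using! this

theorem IsSymm.hasDerivAt_diag {F : CovTensor 𝕜 (m + 1) V} (hF : IsSymm F) (x e : V) (t : ℝ) :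
    HasDerivAt (fun t : ℝ => F (fun _ => x + t • e))
      (((m : 𝕜) + 1) * F.curryLeft e (fun _ => x + t • e)) t := by
  simpa [hF.update_const] using KillingTensor.hasDerivAt_diag F x e t

/-- Polarization by induction on the rank: differentiating the zero polynomial in the direction `e`
shows that the slice `F(e, ·)` also vanishes on the diagonal. -/
theorem IsSymm.eq_zero_of_diag {F : CovTensor 𝕜 m V} (hF : IsSymm F)
    (h : ∀ x, F (fun _ => x) = 0) : F = 0 := by
  induction m with
  | zero =>
    ext v
    simpa [Subsingleton.elim v (fun _ => 0)] using h 0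
  | succ m ih =>
    ext v
    have hc : F.curryLeft (v 0) = 0 := by
      refine ih (hF.curryLeft _) fun x => ?_
      have h1 := hF.hasDerivAt_diag x (v 0) 0
      simp only [h, zero_smul, add_zero] at h1
      have h2 := h1.unique (hasDerivAt_const _ _)
      exact (mul_eq_zero.1 h2).resolve_left (by exact_mod_cast Nat.succ_ne_zero m)
    have := congrArg (fun T => T (Fin.tail v)) hc
    simpa [ContinuousMultilinearMap.curryLeft_apply] using this

theorem IsSymm.add {F G : CovTensor 𝕜 m V} (hF : IsSymm F) (hG : IsSymm G) : IsSymm (F + G) :=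
  fun s v => by simp [hF s v, hG s v]

theorem IsSymm.sub {F G : CovTensor 𝕜 m V} (hF : IsSymm F) (hG : IsSymm G) : IsSymm (F - G) :=
  fun s v => by simp [hF s v, hG s v]

theorem IsSymm.smul {F : CovTensor 𝕜 m V} (hF : IsSymm F) (c : 𝕜) : IsSymm (c • F) :=
  fun s v => by simp [hF s v]

theorem IsSymm.ext_diag {F G : CovTensor 𝕜 m V} (hF : IsSymm F) (hG : IsSymm G)
    (h : ∀ x, F (fun _ => x) = G (fun _ => x)) : F = G :=
  sub_eq_zero.1 ((hF.sub hG).eq_zero_of_diag fun x => by simp [h x])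

/-! ### Symmetrization and symmetric multiplication by the metric. -/

theorem symmetrize_apply (F : CovTensor 𝕜 m V) (v : Fin m → V) :
    symmetrize F v =
      ((Nat.factorial m : ℝ)⁻¹) • ∑ s : Equiv.Perm (Fin m), F (fun a => v (s a)) := by
  simp [symmetrize]

theorem isSymm_symmetrize (F : CovTensor 𝕜 m V) : IsSymm (symmetrize F) := by
  intro s v
  rw [symmetrize_apply, symmetrize_apply]
  congr 1
  exact Fintype.sum_equiv (Equiv.mulLeft s) _ _ fun r => rfl

theorem symmetrize_diag (F : CovTensor 𝕜 m V) (x : V) :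
    symmetrize F (fun _ => x) = F (fun _ => x) := by
  rw [symmetrize_apply, Finset.sum_const, Finset.card_univ, Fintype.card_perm, Fintype.card_fin,
    ← Nat.cast_smul_eq_nsmul ℝ, smul_smul, inv_mul_cancel₀, one_smul]
  exact_mod_cast m.factorial_ne_zero

theorem symmetrize_add (F G : CovTensor 𝕜 m V) :
    symmetrize (F + G) = symmetrize F + symmetrize G := by
  ext v; simp [symmetrize_apply, Finset.sum_add_distrib]

theorem symmetrize_smul (c : 𝕜) (F : CovTensor 𝕜 m V) :
    symmetrize (c • F) = c • symmetrize F := by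
  ext v; simp [symmetrize_apply, ← Finset.mul_sum]

theorem isSymm_iOp (F : CovTensor 𝕜 m V) : IsSymm (iOp F) := isSymm_symmetrize _

theorem iOp_diag (F : CovTensor 𝕜 m V) (x : V) :
    iOp F (fun _ => x) = (inner ℝ x x : ℝ) • F (fun _ => x) := by
  rw [iOp, symmetrize_diag, metricMul_apply]

theorem iOp_add (F G : CovTensor 𝕜 m V) : iOp (F + G) = iOp F + iOp G := by
  rw [iOp, iOp, iOp, ← symmetrize_add]
  congr 1
  ext v; simp [metricMul_apply]

theorem iOp_smul (c : 𝕜) (F : CovTensor 𝕜 m V) : iOp (c • F) = c • iOp F := by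
  rw [iOp, iOp, ← symmetrize_smul]
  congr 1
  ext v; simp [metricMul_apply]

theorem iOp_zero : iOp (0 : CovTensor 𝕜 m V) = 0 := by
  ext v; simp [iOp, symmetrize_apply, metricMul_apply]

theorem iOp_sub (F G : CovTensor 𝕜 m V) : iOp (F - G) = iOp F - iOp G := by
  rw [eq_sub_iff_add_eq, ← iOp_add, sub_add_cancel]

theorem IsSymm.eq_zero_of_diag_ne_zero [Nontrivial V] {F : CovTensor 𝕜 m V} (hF : IsSymm F)
    (h : ∀ x : V, x ≠ 0 → F (fun _ => x) = 0) : F = 0 := by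
  refine hF.eq_zero_of_diag fun x => ?_
  rcases eq_or_ne x 0 with rfl | hx
  · cases m with
    -- A scalar is read off at any nonzero vector; this is where nontriviality of `V` enters.
    | zero =>
      obtain ⟨y, hy⟩ := exists_ne (0 : V)
      rw [← h y hy]
      congr 1
      exact Subsingleton.elim _ _
    | succ m => exact F.map_coord_zero 0 rfl
  · exact h x hx

theorem IsSymm.eq_zero_of_iOp_eq_zero [Nontrivial V] {F : CovTensor 𝕜 m V} (hF : IsSymm F)
    (h : iOp F = 0) : F = 0 := by
  refine hF.eq_zero_of_diag_ne_zero fun x hx => ?_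
  have := iOp_diag F x
  rw [h, zero_apply, eq_comm, smul_eq_zero] at this
  exact this.resolve_left (by simpa using hx)

theorem contDiff_diag (F : CovTensor 𝕜 m V) (x e : V) :
    ContDiff ℝ 2 (fun t : ℝ => F (fun _ => x + t • e)) := by
  refine F.contDiff.comp (contDiff_pi.2 fun _ => ?_)
  fun_prop

/-- Summed over an orthonormal basis, this identifies `j`, up to the factor `(m+2)(m+1)`, with the
Laplacian of the polynomial `x ↦ F(x,…,x)`. -/
theorem IsSymm.deriv_deriv_diag {F : CovTensor 𝕜 (m + 2) V} (hF : IsSymm F) (x e : V) :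
    deriv (deriv fun t : ℝ => F (fun _ => x + t • e)) 0 =
      ((m : 𝕜) + 2) * ((m : 𝕜) + 1) * (F.curryLeft e).curryLeft e (fun _ => x) := by
  have h1 : (deriv fun t : ℝ => F (fun _ => x + t • e)) = _ :=
    funext fun t => (hF.hasDerivAt_diag x e t).deriv
  rw [h1]
  refine (((hF.curryLeft e).hasDerivAt_diag x e 0).const_mul _).deriv.trans ?_
  simp
  ring

variable [FiniteDimensional ℝ V]

/-! ### The contraction with the metric. -/

theorem jOp_apply (F : CovTensor 𝕜 (m + 2) V) (v : Fin m → V) :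
    jOp F v = ∑ a, F (Fin.cons (stdOrthonormalBasis ℝ V a)
      (Fin.cons (stdOrthonormalBasis ℝ V a) v)) := by
  simp [jOp, ContinuousMultilinearMap.curryLeft_apply]

theorem jOp_sub (F G : CovTensor 𝕜 (m + 2) V) : jOp (F - G) = jOp F - jOp G := by
  ext v; simp [jOp_apply]

theorem jOp_smul (c : 𝕜) (F : CovTensor 𝕜 (m + 2) V) : jOp (c • F) = c • jOp F := by
  ext v; simp [jOp_apply, Finset.mul_sum]

theorem isSymm_jOp_of_curryLeft {T : CovTensor 𝕜 (m + 2) V} (hT : ∀ e, IsSymm (T.curryLeft e)) :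
    IsSymm (jOp T) := by
  intro s v
  simp only [jOp, sum_apply]
  exact Finset.sum_congr rfl fun a _ => (hT _).curryLeft _ s v

theorem isSymm_jOp {F : CovTensor 𝕜 (m + 2) V} (hF : IsSymm F) : IsSymm (jOp F) :=
  isSymm_jOp_of_curryLeft fun e => hF.curryLeft e

/-! ### Adjointness of `i` and `j`, and the projection `p` -/

theorem tensorInner_apply (F G : CovTensor 𝕜 m V) :
    tensorInner F G = ∑ J : Fin m → Fin (Module.finrank ℝ V),
      G (fun a => stdOrthonormalBasis ℝ V (J a)) *
        (starRingEnd 𝕜) (F (fun a => stdOrthonormalBasis ℝ V (J a))) := by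
  simp [tensorInner, components, PiLp.inner_apply]

theorem tensorInner_self_eq_zero {F : CovTensor 𝕜 m V} (h : tensorInner F F = 0) : F = 0 :=
  components_injective (by rw [inner_self_eq_zero.1 h, map_zero])

theorem tensorInner_sub_right (F G H : CovTensor 𝕜 m V) :
    tensorInner F (G - H) = tensorInner F G - tensorInner F H := by
  simp [tensorInner, inner_sub_right]

/-- Permuting the arguments of `G` only reindexes the sum over multi-indices, and the symmetric `F`
does not notice it. -/
theorem IsSymm.tensorInner_symmetrize {F : CovTensor 𝕜 m V} (hF : IsSymm F)
    (G : CovTensor 𝕜 m V) : tensorInner F (symmetrize G) = tensorInner F G := by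
  have key (s : Equiv.Perm (Fin m)) : tensorInner F (G.domDomCongr s) = tensorInner F G := by
    rw [tensorInner_apply, tensorInner_apply]
    refine Fintype.sum_equiv (Equiv.arrowCongr s.symm (Equiv.refl _)) _ _ fun J => ?_
    have := hF s (fun a => stdOrthonormalBasis ℝ V (J a))
    simp [← this, Function.comp_def]
  have h : components (symmetrize G) = ((Nat.factorial m : 𝕜)⁻¹) •
      ∑ s : Equiv.Perm (Fin m), components (G.domDomCongr s) := by
    ext J
    simp [components, symmetrize_apply, Algebra.smul_def]
  have h' : tensorInner F (symmetrize G) =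
      ((Nat.factorial m : 𝕜)⁻¹) * ∑ s : Equiv.Perm (Fin m), tensorInner F (G.domDomCongr s) := by
    rw [tensorInner, h, inner_smul_right, inner_sum]
    rfl
  rw [h', Finset.sum_congr rfl fun s _ => key s]
  have : (m.factorial : 𝕜) ≠ 0 := by exact_mod_cast m.factorial_ne_zero
  simp [Fintype.card_perm, this]

/-- The symmetrization in `i` can be dropped against a symmetric `F`; then `⟨e_k, e_l⟩ = δ_kl`
collapses the sum over the first two indices to a trace. -/
theorem IsSymm.tensorInner_iOp {F : CovTensor 𝕜 (m + 2) V} (hF : IsSymm F)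
    (G : CovTensor 𝕜 m V) : tensorInner F (iOp G) = tensorInner (jOp F) G := by
  have hcons (k l : Fin (Module.finrank ℝ V)) (J : Fin m → Fin (Module.finrank ℝ V)) :
      (fun a => stdOrthonormalBasis ℝ V ((Fin.cons k (Fin.cons l J) : Fin (m + 2) → _) a)) =
        (Fin.cons (stdOrthonormalBasis ℝ V k) (Fin.cons (stdOrthonormalBasis ℝ V l)
          fun a => stdOrthonormalBasis ℝ V (J a)) : Fin (m + 2) → V) := by
    funext a
    refine Fin.cases rfl (fun a => Fin.cases rfl (fun a => rfl) a) a
  rw [iOp, hF.tensorInner_symmetrize, tensorInner_apply, tensorInner_apply,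
    ← (Fin.consEquiv fun _ => Fin (Module.finrank ℝ V)).sum_comp, Fintype.sum_prod_type]
  simp_rw [← (Fin.consEquiv fun _ : Fin (m + 1) => Fin (Module.finrank ℝ V)).sum_comp,
    Fintype.sum_prod_type, jOp_apply, map_sum, Finset.mul_sum]
  rw [Finset.sum_comm (s := (Finset.univ : Finset (Fin m → Fin (Module.finrank ℝ V))))]
  refine Finset.sum_congr rfl fun k _ => ?_
  rw [Finset.sum_eq_single k]
  · refine Finset.sum_congr rfl fun J _ => ?_
    erw [hcons]
    simp [metricMul_apply]
  · intro l _ hl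
    refine Finset.sum_eq_zero fun J _ => ?_
    erw [hcons]
    simp [metricMul_apply, (stdOrthonormalBasis ℝ V).inner_eq_zero hl.symm]
  · simp

theorem pOp_mem (F : CovTensor 𝕜 m V) : pOp F ∈ kerJ 𝕜 m V :=
  (existsUnique_projection F).choose_spec.1.1

theorem tensorInner_sub_pOp (F : CovTensor 𝕜 m V) {k : CovTensor 𝕜 m V}
    (hk : k ∈ kerJ 𝕜 m V) : tensorInner k (F - pOp F) = 0 :=
  (existsUnique_projection F).choose_spec.1.2 k hk

theorem pOp_eq {F t : CovTensor 𝕜 m V} (ht : t ∈ kerJ 𝕜 m V)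
    (h : ∀ k ∈ kerJ 𝕜 m V, tensorInner k (F - t) = 0) : pOp F = t :=
  ((existsUnique_projection F).choose_spec.2 t ⟨ht, h⟩).symm

theorem pOp_of_mem {F : CovTensor 𝕜 m V} (hF : F ∈ kerJ 𝕜 m V) : pOp F = F :=
  pOp_eq hF fun k _ => by simp [tensorInner]

theorem pOp_add_iOp {t : CovTensor 𝕜 (m + 2) V} (ht : t ∈ kerJ 𝕜 (m + 2) V)
    (v : CovTensor 𝕜 m V) : pOp (t + iOp v) = t := by
  refine pOp_eq ht fun k hk => ?_
  rw [add_sub_cancel_left, hk.1.tensorInner_iOp, show jOp k = 0 from hk.2]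
  simp [tensorInner]

/-- By adjointness the image of `i` is orthogonal to `Ker j`, so a common element is orthogonal to
itself. -/
theorem iOp_eq_zero_of_mem {v : CovTensor 𝕜 m V} (h : iOp v ∈ kerJ 𝕜 (m + 2) V) :
    iOp v = 0 := by
  apply tensorInner_self_eq_zero
  rw [h.1.tensorInner_iOp, show jOp (iOp v) = 0 from h.2]
  simp [tensorInner]

/-- A symmetric tensor differs from its trace-free part by a symmetric multiple of the metric. -/
theorem IsSymm.exists_sub_pOp_eq_iOp {F : CovTensor 𝕜 (m + 2) V} (hF : IsSymm F) :
    ∃ v : CovTensor 𝕜 m V, IsSymm v ∧ F - pOp F = iOp v := by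
  let S : Submodule 𝕜 (CovTensor 𝕜 (m + 2) V) :=
    { carrier := {x | ∃ v : CovTensor 𝕜 m V, IsSymm v ∧ iOp v = x}
      zero_mem' := ⟨0, fun _ _ => rfl, iOp_zero⟩
      add_mem' := by
        rintro _ _ ⟨v, hv, rfl⟩ ⟨w, hw, rfl⟩
        exact ⟨v + w, hv.add hw, iOp_add v w⟩
      smul_mem' := by
        rintro c _ ⟨v, hv, rfl⟩
        exact ⟨c • v, hv.smul c, iOp_smul c v⟩ }
  set W := S.map components
  obtain ⟨_, ⟨v, hv, rfl⟩, hc⟩ :=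
    Submodule.mem_map.1 (W.starProjection_apply_mem (components (F - pOp F)))
  refine ⟨v, hv, ?_⟩
  have hz : IsSymm (F - pOp F - iOp v) := (hF.sub (pOp_mem F).1).sub (isSymm_iOp v)
  have hort : ∀ w : CovTensor 𝕜 m V, IsSymm w →
      tensorInner (F - pOp F - iOp v) (iOp w) = 0 := fun w hw => by
    rw [tensorInner, inner_eq_zero_symm, map_sub, hc]
    exact (W.mem_orthogonal _).1 (W.sub_starProjection_mem_orthogonal _) _
      (Submodule.mem_map_of_mem ⟨w, hw, rfl⟩)
  -- The residual `z` is orthogonal to all `iw`; the choice `w = jz` gives `⟨jz, jz⟩ = 0`.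
  have hj : jOp (F - pOp F - iOp v) = 0 := by
    apply tensorInner_self_eq_zero
    rw [← hz.tensorInner_iOp]
    exact hort _ (isSymm_jOp hz)
  -- Being trace-free, the residual is orthogonal to `F - pF`, and by construction to `iv`, hence to
  -- itself.
  refine sub_eq_zero.1 (tensorInner_self_eq_zero ?_)
  rw [tensorInner_sub_right, tensorInner_sub_pOp F ⟨hz, hj⟩, hort v hv, sub_zero]

/-! ### Second derivatives along lines and the trace -/

theorem deriv_deriv_add_mul {A B : ℝ → 𝕜} (hA : ContDiff ℝ 2 A) (hB : ContDiff ℝ 2 B) :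
    deriv (deriv fun t : ℝ => A t + (t : 𝕜) * B t) 0 = deriv (deriv A) 0 + 2 * deriv B 0 := by
  have h0 (t : ℝ) : HasDerivAt (fun t : ℝ => (t : 𝕜)) 1 t := by
    simpa using! (RCLike.ofRealCLM (K := 𝕜)).hasDerivAt (x := t)
  have hA1 : Differentiable ℝ A := hA.differentiable (by simp)
  have hB1 : Differentiable ℝ B := hB.differentiable (by simp)
  have hA2 : Differentiable ℝ (deriv A) := (hA.iterate_deriv' 1 1).differentiable (by simp)
  have hB2 : Differentiable ℝ (deriv B) := (hB.iterate_deriv' 1 1).differentiable (by simp)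
  have h1 : (deriv fun t : ℝ => A t + (t : 𝕜) * B t) =
      fun t => deriv A t + (1 * B t + (t : 𝕜) * deriv B t) := by
    funext t
    exact ((hA1 t).hasDerivAt.add ((h0 t).mul (hB1 t).hasDerivAt)).deriv
  rw [h1]
  refine ((hA2 0).hasDerivAt.add (((hB1 0).hasDerivAt.const_mul 1).add
    ((h0 0).mul (hB2 0).hasDerivAt))).deriv.trans ?_
  simp
  ring

/-- A trace-free symmetric tensor is a harmonic polynomial; in ranks 0 and 1 this holds by degree.
-/
theorem sum_deriv_deriv_diag {F : CovTensor 𝕜 m V} (hF : F ∈ kerJ 𝕜 m V) (x : V) :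
    ∑ a, deriv (deriv fun t : ℝ => F (fun _ => x + t • stdOrthonormalBasis ℝ V a)) 0 = 0 := by
  match m, F, hF with
  | 0, F, _ =>
    refine Finset.sum_eq_zero fun a _ => ?_
    have : (fun t : ℝ => F (fun _ => x + t • stdOrthonormalBasis ℝ V a)) =
        fun _ => F (fun _ => x) := funext fun t => congrArg F (Subsingleton.elim _ _)
    simp [this]
  | 1, F, hF =>
    refine Finset.sum_eq_zero fun a _ => ?_
    rw [show (deriv fun t : ℝ => F (fun _ => x + t • stdOrthonormalBasis ℝ V a)) = _ from
      funext fun t => (hF.1.hasDerivAt_diag x _ t).deriv]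
    have : (fun t : ℝ => (((0 : ℕ) : 𝕜) + 1) * F.curryLeft (stdOrthonormalBasis ℝ V a)
          (fun _ => x + t • stdOrthonormalBasis ℝ V a)) =
        fun _ => (((0 : ℕ) : 𝕜) + 1) * F.curryLeft (stdOrthonormalBasis ℝ V a) (fun _ => x) :=
      funext fun t => congrArg (_ * F.curryLeft _ ·) (Subsingleton.elim _ _)
    rw [this, deriv_const]
  | m + 2, F, hF =>
    simp_rw [hF.1.deriv_deriv_diag, ← Finset.mul_sum]
    have := congrArg (fun T => T (fun _ => x)) (show jOp F = 0 from hF.2)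
    simp only [jOp, sum_apply, zero_apply] at this
    rw [this, mul_zero]

theorem IsSymm.mul_jOp_diag {F : CovTensor 𝕜 (m + 2) V} (hF : IsSymm F) (x : V) :
    ((m : 𝕜) + 2) * ((m : 𝕜) + 1) * jOp F (fun _ => x) =
      ∑ a, deriv (deriv fun t : ℝ => F (fun _ => x + t • stdOrthonormalBasis ℝ V a)) 0 := by
  simp_rw [hF.deriv_deriv_diag, ← Finset.mul_sum, jOp, sum_apply]

/-- This is `Δ(|x|² v) = (2n + 4m) v` for a harmonic homogeneous polynomial `v` of degree `m`:
`Δ|x|² = 2n`, and the cross term `4 x·∇v` equals `4mv` by Euler's identity. -/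
theorem smul_jOp_iOp {v : CovTensor 𝕜 m V} (hv : v ∈ kerJ 𝕜 m V) :
    (((m : 𝕜) + 2) * ((m : 𝕜) + 1)) • jOp (iOp v) =
      (2 * ((Module.finrank ℝ V : 𝕜) + 2 * m)) • v := by
  refine ((isSymm_jOp (isSymm_iOp v)).smul _).ext_diag (hv.1.smul _) fun x => ?_
  simp only [smul_apply, smul_eq_mul]
  rw [(isSymm_iOp v).mul_jOp_diag]
  have euler : ∑ a, (inner ℝ x (stdOrthonormalBasis ℝ V a) : 𝕜) *
      deriv (fun t : ℝ => v (fun _ => x + t • stdOrthonormalBasis ℝ V a)) 0 =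
        m * v (fun _ => x) := by
    have h1 (a) := (hasDerivAt_diag v x (stdOrthonormalBasis ℝ V a) 0).deriv
    simp only [h1, zero_smul, add_zero, Finset.mul_sum]
    rw [Finset.sum_comm]
    have h2 (s : Fin m) : ∑ a, (inner ℝ x (stdOrthonormalBasis ℝ V a) : 𝕜) *
        v (Function.update (fun _ => x) s (stdOrthonormalBasis ℝ V a)) = v (fun _ => x) := by
      have h3 : x = ∑ a, (inner ℝ x (stdOrthonormalBasis ℝ V a)) • stdOrthonormalBasis ℝ V a := by
        simpa [real_inner_comm] using ((stdOrthonormalBasis ℝ V).sum_repr' x).symm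
      have h4 := v.toMultilinearMap.map_update_sum Finset.univ s
        (fun a => (inner ℝ x (stdOrthonormalBasis ℝ V a)) • stdOrthonormalBasis ℝ V a) (fun _ => x)
      rw [← h3, Function.update_eq_self s (fun _ : Fin m => x)] at h4
      refine Eq.trans ?_ h4.symm
      refine Finset.sum_congr rfl fun a _ => ?_
      rw [← RCLike.real_smul_eq_coe_mul]
      exact (v.map_update_smul _ s _ _).symm
    simp [h2]
  have h1 (a) : deriv (deriv fun t : ℝ => iOp v (fun _ => x + t • stdOrthonormalBasis ℝ V a)) 0 =
      (inner ℝ x x : 𝕜) * deriv (deriv fun t : ℝ =>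
        v (fun _ => x + t • stdOrthonormalBasis ℝ V a)) 0 + 2 * (2 * ((inner ℝ x
        (stdOrthonormalBasis ℝ V a) : 𝕜) * deriv (fun t : ℝ =>
        v (fun _ => x + t • stdOrthonormalBasis ℝ V a)) 0) + v (fun _ => x)) := by
    set e := stdOrthonormalBasis ℝ V a
    set B : ℝ → 𝕜 := fun t : ℝ => v (fun _ => x + t • e) with hB
    have hBc : ContDiff ℝ 2 B := contDiff_diag v x e
    -- The expansion `|x + te|² = |x|² + 2t⟨x,e⟩ + t²`, grouped to match `deriv_deriv_add_mul`.
    have : (fun t : ℝ => iOp v (fun _ => x + t • e)) = fun t =>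
        (inner ℝ x x : 𝕜) * B t + (t : 𝕜) * (2 * (inner ℝ x e : 𝕜) * B t + (t : 𝕜) * B t) := by
      funext t
      rw [iOp_diag, RCLike.real_smul_eq_coe_mul]
      have hee : inner ℝ e e = (1 : ℝ) := by simp [e]
      simp only [inner_add_left, inner_add_right, inner_smul_left, inner_smul_right, hee,
        real_inner_comm x e, hB]
      simp
      ring
    have hid : ContDiff ℝ 2 fun t : ℝ => (t : 𝕜) := (RCLike.ofRealCLM (K := 𝕜)).contDiff
    rw [this, deriv_deriv_add_mul (contDiff_const.mul hBc)
      ((contDiff_const.mul hBc).add (hid.mul hBc))]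
    have hB1 := (hBc.differentiable (by simp) 0).hasDerivAt
    have h0 : HasDerivAt (fun t : ℝ => (t : 𝕜)) 1 0 := by
      simpa using! (RCLike.ofRealCLM (K := 𝕜)).hasDerivAt (x := 0)
    have h5 := ((hB1.const_mul (2 * (inner ℝ x e : 𝕜))).add (h0.mul hB1)).deriv
    have h6 : deriv (fun t => (inner ℝ x x : 𝕜) * B t) = fun t => (inner ℝ x x : 𝕜) * deriv B t :=
      funext fun t => deriv_const_mul_field _
    rw [h6, deriv_const_mul_field]
    refine congrArg₂ _ rfl (congrArg _ (h5.trans ?_))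
    simp [hB]
    ring
  simp_rw [h1, Finset.sum_add_distrib, ← Finset.mul_sum, Finset.sum_add_distrib, ← Finset.mul_sum,
    euler, sum_deriv_deriv_diag hv]
  simp
  ring

/-- On the diagonal `σT` is `T(x; x,…,x)`. In its Laplacian the first slot is linear, the remaining
slots are harmonic because the slices are trace-free, and only the cross term `2(m+1) jT` survives.
-/
theorem smul_jOp_symmetrize {T : CovTensor 𝕜 (m + 2) V}
    (hT : ∀ e, T.curryLeft e ∈ kerJ 𝕜 (m + 1) V) :
    ((m : 𝕜) + 2) • jOp (symmetrize T) = (2 : 𝕜) • jOp T := by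
  refine ((isSymm_jOp (isSymm_symmetrize T)).smul _).ext_diag
    ((isSymm_jOp_of_curryLeft fun e => (hT e).1).smul _) fun x => ?_
  have hm : (m : 𝕜) + 1 ≠ 0 := by exact_mod_cast m.succ_ne_zero
  apply mul_left_cancel₀ hm
  have h := (isSymm_symmetrize T).mul_jOp_diag x
  simp only [smul_apply, smul_eq_mul]
  have h1 (a) : deriv (deriv fun t : ℝ =>
      symmetrize T (fun _ => x + t • stdOrthonormalBasis ℝ V a)) 0 =
      deriv (deriv fun t : ℝ => T.curryLeft x (fun _ => x + t • stdOrthonormalBasis ℝ V a)) 0 +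
        2 * (((m : 𝕜) + 1) * (T.curryLeft (stdOrthonormalBasis ℝ V a)).curryLeft
          (stdOrthonormalBasis ℝ V a) (fun _ => x)) := by
    set e := stdOrthonormalBasis ℝ V a
    have : (fun t : ℝ => symmetrize T (fun _ => x + t • e)) = fun t : ℝ =>
        T.curryLeft x (fun _ => x + t • e) + (t : 𝕜) * T.curryLeft e (fun _ => x + t • e) := by
      funext t
      have h2 : T (fun _ => x + t • e) = T.curryLeft (x + t • e) (fun _ => x + t • e) := by
        rw [ContinuousMultilinearMap.curryLeft_apply]
        congr 1
        funext b
        refine Fin.cases rfl (fun b => rfl) b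
      rw [symmetrize_diag, h2, map_add, map_smul, add_apply, smul_apply,
        RCLike.real_smul_eq_coe_mul]
    rw [this, deriv_deriv_add_mul (contDiff_diag _ x e) (contDiff_diag _ x e),
      ((hT e).1.hasDerivAt_diag x e 0).deriv]
    simp
  rw [Finset.sum_congr rfl fun a _ => h1 a, Finset.sum_add_distrib,
    sum_deriv_deriv_diag (hT x) x, ← Finset.mul_sum, ← Finset.mul_sum, zero_add] at h
  rw [show jOp T (fun _ => x) = _ from sum_apply _ _ _]
  linear_combination h

theorem jOp_mem_kerJ {T : CovTensor 𝕜 (m + 2) V}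
    (hT : ∀ e, T.curryLeft e ∈ kerJ 𝕜 (m + 1) V) : jOp T ∈ kerJ 𝕜 m V := by
  refine ⟨isSymm_jOp_of_curryLeft fun e => (hT e).1, ?_⟩
  match m, T, hT with
  | 0, _, _ => trivial
  | 1, _, _ => trivial
  | m + 2, T, hT =>
    refine ContinuousMultilinearMap.ext fun v => ?_
    have h1 (a b) : T (Fin.cons (stdOrthonormalBasis ℝ V a) (Fin.cons (stdOrthonormalBasis ℝ V a)
        (Fin.cons (stdOrthonormalBasis ℝ V b) (Fin.cons (stdOrthonormalBasis ℝ V b) v)))) =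
      T.curryLeft (stdOrthonormalBasis ℝ V a) (Fin.cons (stdOrthonormalBasis ℝ V b)
        (Fin.cons (stdOrthonormalBasis ℝ V b) (Fin.cons (stdOrthonormalBasis ℝ V a) v))) := by
      -- Symmetry of the slice `T(e_a, ·)` brings the two `e_b` side by side in the other order of
      -- arguments, so that the double trace of `T` becomes a trace inside one slice.
      rw [← (hT _).1 (Equiv.swap 0 (Fin.succ (Fin.succ 0))), ContinuousMultilinearMap.curryLeft_apply]
      congr 2
      funext i
      refine Fin.cases (by simp; rfl) 
        (fun i => Fin.cases ?_ (fun i => Fin.cases ?_ (fun i => ?_) i) i) i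
      · rw [Equiv.swap_apply_of_ne_of_ne]
        · rfl
        all_goals simp only [ne_eq, Fin.ext_iff, Fin.val_succ, Fin.val_zero]; lia
      · rw [Equiv.swap_apply_right]
        rfl
      · rw [Equiv.swap_apply_of_ne_of_ne]
        · rfl
        all_goals simp only [ne_eq, Fin.ext_iff, Fin.val_succ, Fin.val_zero]; lia
    simp only [jOp_apply, h1]
    rw [Finset.sum_comm]
    refine Finset.sum_eq_zero fun a _ => ?_
    have h2 := congrArg (fun S => S (Fin.cons (stdOrthonormalBasis ℝ V a) v))
      (show jOp (T.curryLeft (stdOrthonormalBasis ℝ V a)) = 0 from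
        (hT (stdOrthonormalBasis ℝ V a)).2)
    simpa only [jOp_apply, zero_apply] using h2

/-- If all the contractions `T(e, ·)` are symmetric and trace-free, then the trace-free part of
the symmetrization of `T` vanishes if and only if this symmetrization is a specific multiple of
`i(jT)`. -/
theorem pOp_symmetrize_eq_zero_iff [Nontrivial V] {T : CovTensor 𝕜 (m + 2) V}
    (hT : ∀ e, T.curryLeft e ∈ kerJ 𝕜 (m + 1) V) :
    pOp (symmetrize T) = 0 ↔
      symmetrize T = iOp ((((m : 𝕜) + 1) / ((Module.finrank ℝ V : 𝕜) + 2 * m)) • jOp T) := by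
  constructor
  · intro h
    obtain ⟨w, -, hw⟩ := (isSymm_symmetrize T).exists_sub_pOp_eq_iOp
    rw [h, sub_zero] at hw
    -- The value of `c` makes the traces of the two sides agree: `jσT = 2/(m+2) jT`, while `j i(jT)
    -- = 2(n+2m)/((m+2)(m+1)) jT`. The difference then lies both in the image of `i` and in `Ker j`.
    set c : 𝕜 := ((m : 𝕜) + 1) / ((Module.finrank ℝ V : 𝕜) + 2 * m) with hc
    rw [← sub_eq_zero, hw, ← iOp_sub]
    apply iOp_eq_zero_of_mem
    refine ⟨isSymm_iOp _, ?_⟩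
    change jOp _ = 0
    rw [iOp_sub, ← hw, jOp_sub, iOp_smul, jOp_smul]
    have h1 := smul_jOp_symmetrize hT
    have h2 := smul_jOp_iOp (jOp_mem_kerJ hT)
    have hm1 : (m : 𝕜) + 1 ≠ 0 := by exact_mod_cast m.succ_ne_zero
    have hm2 : (m : 𝕜) + 2 ≠ 0 := by exact_mod_cast (m + 1).succ_ne_zero
    have hn : (Module.finrank ℝ V : 𝕜) + 2 * m ≠ 0 := by
      have : 0 < Module.finrank ℝ V := Module.finrank_pos
      exact_mod_cast (by lia : Module.finrank ℝ V + 2 * m ≠ 0)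
    ext v
    have h1' := congrArg (fun S => S v) h1
    have h2' := congrArg (fun S => S v) h2
    simp only [smul_apply, sub_apply, zero_apply, smul_eq_mul] at h1' h2' ⊢
    apply mul_left_cancel₀ (mul_ne_zero hm1 hm2)
    have hcn : c * ((Module.finrank ℝ V : 𝕜) + 2 * m) = (m : 𝕜) + 1 := div_mul_cancel₀ _ hn
    linear_combination ((m : 𝕜) + 1) * h1' - c * h2' - 2 * jOp T v * hcn
  · intro h
    rw [h]
    simpa using pOp_add_iOp (kerJ 𝕜 (m + 2) V).zero_mem _

end Algebra

section Smoothness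

variable {𝕜 : Type*} [RCLike 𝕜] {m : ℕ} {V : Type*} [NormedAddCommGroup V]
  [InnerProductSpace ℝ V] {E : Type*} [NormedAddCommGroup E] [NormedSpace ℝ E]

/-! ### Smooth families of tensors -/

/-- The product of a tensor `f` of rank `m` with a bilinear form, before symmetrization. -/
def formMul (B : V →L[ℝ] V →L[ℝ] ℝ) (f : CovTensor 𝕜 m V) : CovTensor 𝕜 (m + 2) V :=
  ContinuousLinearMap.uncurryLeft
    ((continuousMultilinearCurryLeftEquiv ℝ (fun _ : Fin (m + 1) => V)
        𝕜).symm.toContinuousLinearEquiv.toContinuousLinearMap.comp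
      (((ContinuousLinearMap.smulRightL ℝ V (CovTensor 𝕜 m V)).flip f).comp B))

theorem formMul_apply (B : V →L[ℝ] V →L[ℝ] ℝ) (f : CovTensor 𝕜 m V) (w : Fin (m + 2) → V) :
    formMul B f w = B (w 0) (w 1) • f (fun a => w a.succ.succ) := rfl

theorem contDiffOn_covTensor_apply {φ : E → CovTensor 𝕜 m V} {s : Set E}
    (h : ContDiffOn ℝ ∞ φ s) (v : Fin m → V) : ContDiffOn ℝ ∞ (fun u => φ u v) s :=
  (ContinuousMultilinearMap.apply ℝ (fun _ : Fin m => V) 𝕜 v).contDiff.comp_contDiffOn h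

/-- Symmetric multiplication by a bilinear form, as a linear map. -/
def symmFormMul (B : V →L[ℝ] V →L[ℝ] ℝ) : CovTensor 𝕜 m V →ₗ[ℝ] CovTensor 𝕜 (m + 2) V where
  toFun f := symmetrize (formMul B f)
  map_add' f g := by
    ext v; simp [symmetrize_apply, formMul_apply, Finset.sum_add_distrib]
  map_smul' c f := by
    ext v
    simp only [symmetrize_apply, formMul_apply, smul_apply, RingHom.id_apply]
    simp only [RCLike.real_smul_eq_coe_mul, Finset.mul_sum]
    exact Finset.sum_congr rfl fun r _ => by ring

variable [FiniteDimensional ℝ V]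

instance : FiniteDimensional ℝ (CovTensor 𝕜 m V) :=
  FiniteDimensional.of_injective (components.restrictScalars ℝ : CovTensor 𝕜 m V →ₗ[ℝ] _)
    components_injective

theorem contDiffOn_covTensor {φ : E → CovTensor 𝕜 m V} {s : Set E}
    (h : ∀ v, ContDiffOn ℝ ∞ (fun u => φ u v) s) : ContDiffOn ℝ ∞ φ s := by
  obtain ⟨L, hL⟩ := LinearMap.exists_leftInverse_of_injective
    (components.restrictScalars ℝ : CovTensor 𝕜 m V →ₗ[ℝ] _)
    (LinearMap.ker_eq_bot.2 components_injective)
  have h1 : φ = fun u => L.toContinuousLinearMap (components (φ u)) :=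
    funext fun u => (LinearMap.congr_fun hL (φ u)).symm
  rw [h1]
  refine L.toContinuousLinearMap.contDiff.comp_contDiffOn ?_
  exact contDiffOn_piLp _ |>.2 fun J => h _

theorem contDiffOn_symmetrize_formMul {B : E → V →L[ℝ] V →L[ℝ] ℝ} {φ : E → CovTensor 𝕜 m V}
    {s : Set E} (hB : ContDiffOn ℝ ∞ B s) (hφ : ContDiffOn ℝ ∞ φ s) :
    ContDiffOn ℝ ∞ (fun u => symmetrize (formMul (B u) (φ u))) s := by
  refine contDiffOn_covTensor fun v => ?_
  simp only [symmetrize_apply, formMul_apply]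
  refine ContDiffOn.const_smul _ (ContDiffOn.sum fun r _ => ?_)
  exact ((hB.clm_apply contDiffOn_const).clm_apply contDiffOn_const).smul
    (contDiffOn_covTensor_apply hφ _)

/-! ### Smooth dependence of solutions of injective linear equations. -/

theorem contDiffAt_of_injective {S W : Type*} [NormedAddCommGroup S] [NormedSpace ℝ S]
    [FiniteDimensional ℝ S] [NormedAddCommGroup W] [NormedSpace ℝ W] [FiniteDimensional ℝ W]
    {I : E → S →L[ℝ] W} {φ : E → S} {u₀ : E} (hI : ContDiffAt ℝ ∞ I u₀)
    (hinj : Function.Injective (I u₀)) (h : ContDiffAt ℝ ∞ (fun u => I u (φ u)) u₀) :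
    ContDiffAt ℝ ∞ φ u₀ := by
  -- With `L` a left inverse of `I u₀`, the operator `L ∘ I u` is the identity at `u₀`, hence
  -- invertible nearby, and `φ = (L ∘ I)⁻¹ L (Iφ)` there.
  obtain ⟨L', hL'⟩ := LinearMap.exists_leftInverse_of_injective (I u₀ : S →ₗ[ℝ] W)
    (LinearMap.ker_eq_bot.2 hinj)
  set L : W →L[ℝ] S := L'.toContinuousLinearMap
  have : CompleteSpace S := FiniteDimensional.complete ℝ S
  have hA : ContDiffAt ℝ ∞ (fun u => L.comp (I u)) u₀ :=
    (contDiffAt_const (c := L)).clm_comp hI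
  have hA0 : L.comp (I u₀) = ((1 : (S →L[ℝ] S)ˣ) : S →L[ℝ] S) :=
    ContinuousLinearMap.ext fun x => LinearMap.congr_fun hL' x
  have hinv : ContDiffAt ℝ ∞ (fun u => Ring.inverse (L.comp (I u))) u₀ := by
    have h1 : ContDiffAt ℝ ∞ Ring.inverse (L.comp (I u₀)) := by
      rw [hA0]
      exact contDiffAt_ringInverse ℝ _
    exact h1.comp u₀ hA
  have hunit : ∀ᶠ u in nhds u₀, IsUnit (L.comp (I u)) := by
    refine hA.continuousAt.eventually (?_ : ∀ᶠ A in nhds (L.comp (I u₀)), IsUnit A)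
    rw [hA0]
    exact Units.nhds 1
  refine (hinv.clm_apply (L.contDiff.contDiffAt.comp u₀ h)).congr_of_eventuallyEq ?_
  filter_upwards [hunit] with u hu
  have := Ring.inverse_mul_cancel _ hu
  exact (DFunLike.congr_fun this (φ u)).symm

/-- The passage to a subspace `S` is needed because multiplication by the metric is injective only
on symmetric tensors. -/
theorem contDiffAt_of_injOn {X W : Type*} [NormedAddCommGroup X] [NormedSpace ℝ X]
    [FiniteDimensional ℝ X] [NormedAddCommGroup W] [NormedSpace ℝ W] [FiniteDimensional ℝ W]
    {J : E → X →ₗ[ℝ] W} {S : Submodule ℝ X} {φ : E → X} {s : Set E} {u₀ : E} (hs : s ∈ nhds u₀)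
    (hJ : ∀ f ∈ S, ContDiffOn ℝ ∞ (fun u => J u f) s)
    (hinj : ∀ f ∈ S, J u₀ f = 0 → f = 0) (hφ : ∀ u, φ u ∈ S)
    (h : ContDiffOn ℝ ∞ (fun u => J u (φ u)) s) : ContDiffAt ℝ ∞ φ u₀ := by
  let I (u : E) : S →L[ℝ] W := LinearMap.toContinuousLinearMap ((J u).comp S.subtype)
  have key : ContDiffAt ℝ ∞ (fun u => (⟨φ u, hφ u⟩ : S)) u₀ := by
    refine contDiffAt_of_injective (I := I) ?_ ?_ (h.contDiffAt hs)
    · exact ContDiffOn.contDiffAt (contDiffOn_clm_apply.2 fun f => hJ f f.2) hs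
    · rw [injective_iff_map_eq_zero]
      exact fun f hf => Subtype.ext (hinj f f.2 hf)
  exact S.subtypeL.contDiff.contDiffAt.comp u₀ key

theorem contDiffAt_of_symmetrize_formMul [Nontrivial V] {B : E → V →L[ℝ] V →L[ℝ] ℝ}
    {φ : E → CovTensor 𝕜 m V} {s : Set E} {u₀ : E} (hs : s ∈ nhds u₀)
    (hB : ContDiffOn ℝ ∞ B s) (hpos : ∀ x, x ≠ 0 → B u₀ x x ≠ 0) (hφ : ∀ u, IsSymm (φ u))
    (h : ContDiffOn ℝ ∞ (fun u => symmetrize (formMul (B u) (φ u))) s) :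
    ContDiffAt ℝ ∞ φ u₀ := by
  let S : Submodule ℝ (CovTensor 𝕜 m V) :=
    { carrier := {f | IsSymm f}
      zero_mem' := fun _ _ => rfl
      add_mem' := IsSymm.add
      smul_mem' := fun c f hf s v => by simp [hf s v] }
  refine contDiffAt_of_injOn (J := fun u => symmFormMul (B u)) (S := S) hs
    (fun f _ => contDiffOn_symmetrize_formMul hB contDiffOn_const) (fun f hf h0 => ?_) hφ h
  refine IsSymm.eq_zero_of_diag_ne_zero hf fun x hx => ?_
  have := congrArg (fun T => T (fun _ => x)) h0
  simp only [symmFormMul, LinearMap.coe_mk, AddHom.coe_mk, symmetrize_diag, formMul_apply,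
    zero_apply, smul_eq_zero] at this
  exact this.resolve_left (hpos x hx)

/-- The contraction `j` computed in an arbitrary frame `P`, by means of the inverse `R` of the
Gram operator `H` of this frame. -/
theorem jOp_eq_sum_frame {ι : Type*} [Fintype ι] {W : Type*} [NormedAddCommGroup W]
    [InnerProductSpace ℝ W] [FiniteDimensional ℝ W] (b : OrthonormalBasis ι ℝ W)
    (hdim : Module.finrank ℝ W = Module.finrank ℝ V) {P : W →ₗ[ℝ] V} {H R : W →ₗ[ℝ] W}
    (hH : ∀ x y, inner ℝ (H x) y = inner ℝ (P x) (P y)) (hR : ∀ x, R (H x) = x)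
    (F : CovTensor 𝕜 (m + 2) V) (v : Fin m → V) :
    ∑ k, F (Fin.cons (P (R (b k))) (Fin.cons (P (b k)) v)) = jOp F v := by
  have hinj : Function.Injective P := by
    rw [injective_iff_map_eq_zero]
    intro x hx
    have h0 : H x = 0 := by
      rw [← inner_self_eq_zero (𝕜 := ℝ), hH, hx, inner_zero_left]
    rw [← hR x, h0, map_zero]
  have hsurj := (LinearMap.injective_iff_surjective_of_finrank_eq_finrank hdim).1 hinj
  let Φ (x y : V) : 𝕜 := (F.curryLeft x).curryLeft y v
  have hΦ (x y : V) : F (Fin.cons x (Fin.cons y v)) = Φ x y := rfl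
  let ΦL : V →ₗ[ℝ] V →ₗ[ℝ] 𝕜 := LinearMap.mk₂ ℝ Φ
    (fun x x' y => by simp only [Φ, map_add]; rfl)
    (fun c x y => by simp only [Φ, map_smul]; rfl)
    (fun x y y' => by simp only [Φ, map_add, add_apply])
    (fun c x y => by simp only [Φ, map_smul, smul_apply])
  have hΦL (x y : V) : Φ x y = ΦL x y := rfl
  rw [jOp_apply]
  simp only [hΦ, hΦL]
  -- With `Pβ_a` the orthonormal basis of `V`, the coefficients of `P b_k` are `⟨Hβ_a, b_k⟩`;
  -- summing over `k` turns `R b_k` into `R H β_a = β_a`.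
  choose β hβ using fun a => hsurj (stdOrthonormalBasis ℝ V a)
  have h1 (k) : P (b k) = ∑ a, (inner ℝ (H (β a)) (b k) : ℝ) • stdOrthonormalBasis ℝ V a := by
    simp_rw [hH, hβ]
    exact ((stdOrthonormalBasis ℝ V).sum_repr' _).symm
  have h2 (a) : ∑ k, (inner ℝ (H (β a)) (b k) : ℝ) • b k = H (β a) := by
    simpa [real_inner_comm] using b.sum_repr' (H (β a))
  calc ∑ k, ΦL (P (R (b k))) (P (b k))
      = ∑ k, ∑ a, ΦL (P (R ((inner ℝ (H (β a)) (b k) : ℝ) • b k))) (stdOrthonormalBasis ℝ V a) := by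
        refine Finset.sum_congr rfl fun k _ => ?_
        conv_lhs => rw [h1 k]
        simp
    _ = ∑ a, ΦL (P (R (∑ k, (inner ℝ (H (β a)) (b k) : ℝ) • b k))) (stdOrthonormalBasis ℝ V a) := by
        rw [Finset.sum_comm]
        simp only [map_sum, LinearMap.sum_apply]
    _ = _ := by simp only [h2, hR, hβ]

theorem hasDerivAt_sum_smul {ι X : Type*} [Fintype ι] [NormedAddCommGroup X] [NormedSpace ℝ X]
    {g : ι → ι → ℝ → ℝ} (b : ι → ι → X) (h : ∀ i j, HasDerivAt (g i j) 0 0) :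
    HasDerivAt (fun t => ∑ i, ∑ j, g i j t • b i j) 0 0 := by
  have : HasDerivAt (fun t => ∑ i, ∑ j, g i j t • b i j) (∑ i, ∑ j, (0 : ℝ) • b i j) 0 :=
    HasDerivAt.fun_sum fun i _ => HasDerivAt.fun_sum fun j _ => (h i j).smul_const _
  simpa using this

theorem hasDerivAt_ringInverse_zero {R : Type*} [NormedRing R] [NormedAlgebra ℝ R]
    [HasSummableGeomSeries R] {H : ℝ → R} (h : HasDerivAt H 0 0) (hu : IsUnit (H 0)) :
    HasDerivAt (fun t => Ring.inverse (H t)) 0 0 := by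
  obtain ⟨a, ha⟩ := hu
  have h1 := hasFDerivAt_ringInverse (𝕜 := ℝ) a
  rw [ha] at h1
  have h2 := h1.comp_hasDerivAt (0 : ℝ) h
  rwa [map_zero] at h2

/-- The operator on `ℝⁿ` with given matrix elements. -/
def gramOperator {n : ℕ} (G : Fin n → Fin n → ℝ) :
    EuclideanSpace ℝ (Fin n) →L[ℝ] EuclideanSpace ℝ (Fin n) :=
  ∑ i, ∑ j, G i j •
    (EuclideanSpace.proj (𝕜 := ℝ) i).smulRight (EuclideanSpace.single j (1 : ℝ))

theorem inner_gramOperator {n : ℕ}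
    (B : EuclideanSpace ℝ (Fin n) →L[ℝ] EuclideanSpace ℝ (Fin n) →L[ℝ] ℝ)
    (x y : EuclideanSpace ℝ (Fin n)) :
    inner ℝ (gramOperator (fun i j => B (EuclideanSpace.basisFun (Fin n) ℝ i)
      (EuclideanSpace.basisFun (Fin n) ℝ j)) x) y = B x y := by
  have hsum (a : EuclideanSpace ℝ (Fin n)) :
      a = ∑ i, a i • EuclideanSpace.basisFun (Fin n) ℝ i :=
    ((EuclideanSpace.basisFun (Fin n) ℝ).sum_repr a).symm
  conv_rhs => rw [hsum x, hsum y]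
  simp only [gramOperator, map_sum, sum_apply, map_smul, smul_apply, smul_eq_mul, sum_inner,
    ContinuousLinearMap.smulRight_apply, inner_smul_left, EuclideanSpace.inner_single_left]
  rw [Finset.sum_comm]
  refine Finset.sum_congr rfl fun i _ => ?_
  rw [Finset.mul_sum]
  refine Finset.sum_congr rfl fun j _ => ?_
  simp
  ring

end Smoothness

section Charts

variable {n : ℕ} {M : Type*} [TopologicalSpace M] [ChartedSpace (EuclideanSpace ℝ (Fin n)) M]

/-! ### Frames and metric in charts -/

section Frame

theorem coordFrame_eq_mfderivWithin (c : M) (u : EuclideanSpace ℝ (Fin n)) :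
    coordFrame c u =
      mfderivWithin (𝓡 n) (𝓡 n) (extChartAt (𝓡 n) c).symm (Set.range (𝓡 n)) u := by
  rw [ModelWithCorners.range_eq_univ, mfderivWithin_univ]
  rfl

variable [IsManifold (𝓡 n) ∞ M]

theorem coordFrame_injective {c : M} {u : EuclideanSpace ℝ (Fin n)}
    (hu : u ∈ (extChartAt (𝓡 n) c).target) : Function.Injective (coordFrame c u) := by
  have : IsManifold (𝓡 n) 1 M := IsManifold.of_le (n := ∞) (by simp)
  rw [coordFrame_eq_mfderivWithin]
  exact (isInvertible_mfderivWithin_extChartAt_symm hu).injective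

theorem chartDifferential_comp (x : M) (a : EuclideanSpace ℝ (Fin n)) :
    chartDifferential x (coordFrame x (extChartAt (𝓡 n) x x) a : EuclideanSpace ℝ (Fin n)) = a := by
  have : IsManifold (𝓡 n) 1 M := IsManifold.of_le (n := ∞) (by simp)
  have h := mfderiv_extChartAt_comp_mfderivWithin_extChartAt_symm' (I := 𝓡 n)
    (mem_extChartAt_source (I := 𝓡 n) x)
  rw [coordFrame_eq_mfderivWithin]
  exact DFunLike.congr_fun h a

theorem contMDiffOn_coordFrame (c : M) (a : EuclideanSpace ℝ (Fin n)) :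
    ContMDiffOn (𝓡 n) ((𝓡 n).prod (𝓡 n)) ∞
      (fun u => (⟨(extChartAt (𝓡 n) c).symm u, coordFrame c u a⟩ : TangentBundle (𝓡 n) M))
      (extChartAt (𝓡 n) c).target := by
  have : IsManifold (𝓡 n) 1 M := IsManifold.of_le (n := ∞) (by simp)
  have h1 := (contMDiffOn_extChartAt_symm (I := 𝓡 n) (n := ∞) c).contMDiffOn_tangentMapWithin
    (m := ∞) (by simp) (isOpen_extChartAt_target c).uniqueMDiffOn
  have h2 := (contMDiff_vectorSpace_iff_contDiff (𝕜 := ℝ) (n := ∞)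
    (V := fun _ : EuclideanSpace ℝ (Fin n) => a)).2 contDiff_const
  refine (h1.comp h2.contMDiffOn (fun u hu => hu)).congr fun u hu => ?_
  simp only [Function.comp, tangentMapWithin]
  rw [mfderivWithin_of_isOpen (isOpen_extChartAt_target c) hu]
  rfl

/-- The coordinate frame of the chart around `x`, at the point `x`. -/
def centerFrame (x : M) : EuclideanSpace ℝ (Fin n) →L[ℝ] TangentSpace (𝓡 n) x :=
  coordFrame x (extChartAt (𝓡 n) x x)

theorem chartDifferential_centerFrame (x : M) (a : EuclideanSpace ℝ (Fin n)) :
    chartDifferential x (centerFrame x a) = a := chartDifferential_comp x a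

theorem centerFrame_chartDifferential (x : M) (v : TangentSpace (𝓡 n) x) :
    centerFrame x (chartDifferential x v) = v := by
  have hinj : Function.Injective (centerFrame (n := n) x).toLinearMap :=
    Function.LeftInverse.injective (chartDifferential_centerFrame x)
  obtain ⟨a, rfl⟩ :=
    (LinearMap.injective_iff_surjective_of_finrank_eq_finrank rfl).1 hinj v
  exact congrArg (centerFrame x) (chartDifferential_centerFrame x a)

end Frame

variable [RiemannianBundle (fun x : M => TangentSpace (𝓡 n) x)]

/-- The metric tensor in the chart around `c`, as a bilinear form on `ℝⁿ`. -/
def chartForm (c : M) (u : EuclideanSpace ℝ (Fin n)) :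
    EuclideanSpace ℝ (Fin n) →L[ℝ] EuclideanSpace ℝ (Fin n) →L[ℝ] ℝ :=
  (innerSL ℝ).bilinearComp (coordFrame c u) (coordFrame c u)

theorem chartForm_apply (c : M) (u a b : EuclideanSpace ℝ (Fin n)) :
    chartForm c u a b = inner ℝ (coordFrame c u a) (coordFrame c u b) := rfl

theorem chartForm_comm (c : M) (u a b : EuclideanSpace ℝ (Fin n)) :
    chartForm c u a b = chartForm c u b a := by
  rw [chartForm_apply, chartForm_apply, real_inner_comm]

theorem metricCoeff_eq (c : M) (u : EuclideanSpace ℝ (Fin n)) (i j : Fin n) :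
    metricCoeff c u i j =
      chartForm c u (EuclideanSpace.single i 1) (EuclideanSpace.single j 1) := rfl

theorem euclidean_eq_sum (a : EuclideanSpace ℝ (Fin n)) :
    a = ∑ i, a i • EuclideanSpace.single i (1 : ℝ) := by
  simpa using ((EuclideanSpace.basisFun (Fin n) ℝ).sum_repr a).symm

theorem chartForm_eq_sum (c : M) (u a b : EuclideanSpace ℝ (Fin n)) :
    chartForm c u a b = ∑ i, ∑ j, a i * b j * metricCoeff c u i j := by
  conv_lhs => rw [euclidean_eq_sum a, euclidean_eq_sum b]
  simp only [map_sum, sum_apply, map_smul, smul_apply, smul_eq_mul, metricCoeff_eq, Finset.mul_sum]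
  rw [Finset.sum_comm]
  exact Finset.sum_congr rfl fun i _ => Finset.sum_congr rfl fun j _ => by ring

theorem metricDeriv_comm (c : M) (u : EuclideanSpace ℝ (Fin n)) (k i j : Fin n) :
    metricDeriv c u k i j = metricDeriv c u k j i := by
  simp only [metricDeriv, metricCoeff_eq, chartForm_comm c _ (EuclideanSpace.single i 1)]

variable [IsManifold (𝓡 n) ∞ M]

theorem chartForm_self_pos {c : M} {u : EuclideanSpace ℝ (Fin n)}
    (hu : u ∈ (extChartAt (𝓡 n) c).target) {a : EuclideanSpace ℝ (Fin n)} (ha : a ≠ 0) :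
    0 < chartForm c u a a := by
  rw [chartForm_apply]
  refine real_inner_self_pos.2 fun h => ha (coordFrame_injective hu ?_)
  rw [h, map_zero]

/-- A vector in the kernel of the Gram matrix would have zero length. -/
theorem isUnit_metricCoeff {c : M} {u : EuclideanSpace ℝ (Fin n)}
    (hu : u ∈ (extChartAt (𝓡 n) c).target) : IsUnit (metricCoeff c u) := by
  rw [← Matrix.mulVec_injective_iff_isUnit]
  refine (injective_iff_map_eq_zero (metricCoeff c u).mulVecLin).2 fun x hx => ?_
  by_contra hne
  have h := chartForm_self_pos hu (a := WithLp.toLp 2 x) (by simpa using hne)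
  refine h.ne' ?_
  rw [chartForm_eq_sum]
  refine Finset.sum_eq_zero fun i _ => ?_
  have := congrFun hx i
  simp only [Matrix.mulVecLin_apply, Matrix.mulVec, dotProduct, Pi.zero_apply] at this
  rw [← mul_zero (x i), ← this, Finset.mul_sum]
  exact Finset.sum_congr rfl fun j _ => by simp; ring

theorem sum_christoffel_mul_metricCoeff {c : M} {u : EuclideanSpace ℝ (Fin n)}
    (hu : u ∈ (extChartAt (𝓡 n) c).target) (i j p : Fin n) :
    ∑ k, christoffel c u k i j * metricCoeff c u k p =
      (1 / 2) * (metricDeriv c u i j p + metricDeriv c u j i p - metricDeriv c u p i j) := by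
  have h1 : metricCoeff c u * (metricCoeff c u)⁻¹ = 1 :=
    Matrix.mul_nonsing_inv _ ((Matrix.isUnit_iff_isUnit_det _).1 (isUnit_metricCoeff hu))
  have h2 (l : Fin n) :
      ∑ k, (metricCoeff c u)⁻¹ k l * metricCoeff c u k p = if p = l then 1 else 0 := by
    rw [← Matrix.one_apply, ← h1, Matrix.mul_apply]
    exact Finset.sum_congr rfl fun k _ => by
      rw [metricCoeff_eq, metricCoeff_eq, chartForm_comm, mul_comm]
  set X : Fin n → ℝ := fun l =>
    metricDeriv c u i j l + metricDeriv c u j i l - metricDeriv c u l i j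
  calc ∑ k, christoffel c u k i j * metricCoeff c u k p
      = ∑ k, ∑ l, (1 / 2) * (((metricCoeff c u)⁻¹ k l * metricCoeff c u k p) * X l) := by
        refine Finset.sum_congr rfl fun k _ => ?_
        rw [christoffel, Finset.mul_sum, Finset.sum_mul]
        exact Finset.sum_congr rfl fun l _ => by ring
    _ = (1 / 2) * ∑ l, (∑ k, (metricCoeff c u)⁻¹ k l * metricCoeff c u k p) * X l := by
        rw [Finset.sum_comm]
        simp only [Finset.mul_sum, Finset.sum_mul]
    _ = (1 / 2) * X p := by simp [h2]

theorem sum_rotate (G : Fin n → Fin n → Fin n → ℝ) :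
    ∑ k, ∑ p, ∑ i, G k p i = ∑ i, ∑ k, ∑ p, G k p i := by
  rw [Finset.sum_comm (f := fun i k => ∑ p, G k p i)]
  exact Finset.sum_congr rfl fun k _ => Finset.sum_comm

theorem chartForm_christoffelMap {c : M} {u : EuclideanSpace ℝ (Fin n)}
    (hu : u ∈ (extChartAt (𝓡 n) c).target) (w a b : EuclideanSpace ℝ (Fin n)) :
    chartForm c u (christoffelMap c u w a) b = ∑ i, ∑ j, ∑ p, w i * a j * b p *
      ((1 / 2) * (metricDeriv c u i j p + metricDeriv c u j i p - metricDeriv c u p i j)) := by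
  have h1 (k : Fin n) : (christoffelMap c u w a) k =
      ∑ i, ∑ j, christoffel c u k i j * (w i * a j) := by
    simp [christoffelMap, Finset.sum_apply, Pi.single_apply]
  rw [chartForm_eq_sum]
  simp only [← sum_christoffel_mul_metricCoeff hu, h1, Finset.mul_sum, Finset.sum_mul]
  rw [sum_rotate]
  refine Finset.sum_congr rfl fun i _ => ?_
  rw [sum_rotate]
  refine Finset.sum_congr rfl fun j _ => ?_
  rw [Finset.sum_comm]
  exact Finset.sum_congr rfl fun p _ => Finset.sum_congr rfl fun k _ => by ring

variable [IsContMDiffRiemannianBundle (𝓡 n) ∞ (EuclideanSpace ℝ (Fin n))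
      (fun x : M => TangentSpace (𝓡 n) x)]

theorem contDiffOn_chartForm_apply (c : M) (a b : EuclideanSpace ℝ (Fin n)) :
    ContDiffOn ℝ ∞ (fun u => chartForm c u a b) (extChartAt (𝓡 n) c).target := by
  rw [← contMDiffOn_iff_contDiffOn]
  exact (contMDiffOn_coordFrame c a).inner_bundle (contMDiffOn_coordFrame c b)

theorem contDiffOn_chartForm (c : M) :
    ContDiffOn ℝ ∞ (chartForm c) (extChartAt (𝓡 n) c).target :=
  contDiffOn_clm_apply.2 fun a => contDiffOn_clm_apply.2 fun b => contDiffOn_chartForm_apply c a b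

theorem differentiableAt_chartForm_apply {c : M} {u : EuclideanSpace ℝ (Fin n)}
    (hu : u ∈ (extChartAt (𝓡 n) c).target) (a b : EuclideanSpace ℝ (Fin n)) :
    DifferentiableAt ℝ (fun u => chartForm c u a b) u :=
  ((contDiffOn_chartForm_apply c a b).contDiffAt
    ((isOpen_extChartAt_target c).mem_nhds hu)).differentiableAt (by simp)

/-- The Levi-Civita connection is compatible with the metric. -/
theorem fderiv_chartForm {c : M} {u : EuclideanSpace ℝ (Fin n)}
    (hu : u ∈ (extChartAt (𝓡 n) c).target) (w a b : EuclideanSpace ℝ (Fin n)) :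
    fderiv ℝ (fun u => chartForm c u a b) u w =
      chartForm c u (christoffelMap c u w a) b + chartForm c u a (christoffelMap c u w b) := by
  rw [chartForm_comm c u a, chartForm_christoffelMap hu, chartForm_christoffelMap hu]
  have hd (i j : Fin n) : DifferentiableAt ℝ (fun u => metricCoeff c u i j) u :=
    differentiableAt_chartForm_apply hu _ _
  have h1 (i j : Fin n) : fderiv ℝ (fun u => metricCoeff c u i j) u w =
      ∑ k, w k * metricDeriv c u k i j := by
    conv_lhs => rw [euclidean_eq_sum w]
    simp [metricDeriv]
  have h2 : HasFDerivAt (fun u => chartForm c u a b)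
      (∑ i, ∑ j, (a i * b j) • fderiv ℝ (fun u => metricCoeff c u i j) u) u := by
    simp only [chartForm_eq_sum]
    exact HasFDerivAt.fun_sum fun i _ => HasFDerivAt.fun_sum fun j _ =>
      (hd i j).hasFDerivAt.const_mul _
  rw [h2.fderiv, ← Finset.sum_add_distrib]
  simp only [sum_apply, smul_apply, smul_eq_mul, h1, Finset.mul_sum]
  rw [sum_rotate]
  refine Finset.sum_congr rfl fun i _ => ?_
  rw [Finset.sum_comm (f := fun j p => w i * b j * a p * _), ← Finset.sum_add_distrib]
  refine Finset.sum_congr rfl fun j _ => ?_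
  rw [← Finset.sum_add_distrib]
  refine Finset.sum_congr rfl fun p _ => ?_
  -- Of the two Christoffel symbols of the first kind, the terms differentiated in the directions
  -- `j` and `p` cancel, and the two halves of `∂_i g` add up.
  rw [metricDeriv_comm c u i p j, metricDeriv_comm c u p i j, metricDeriv_comm c u j i p]
  ring

/-- Along a straight line in a chart, vectors transported by means of the Christoffel symbols keep
their scalar products up to the first order. -/
theorem hasDerivAt_chartForm {c : M} {u : EuclideanSpace ℝ (Fin n)}
    (hu : u ∈ (extChartAt (𝓡 n) c).target) (w a b : EuclideanSpace ℝ (Fin n)) :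
    HasDerivAt (fun t : ℝ => chartForm c (u + t • w) (a - t • christoffelMap c u w a)
      (b - t • christoffelMap c u w b)) 0 0 := by
  have hline : HasDerivAt (fun t : ℝ => u + t • w) w 0 := by
    simpa using ((hasDerivAt_id (0 : ℝ)).smul_const w).const_add u
  have hq (a b : EuclideanSpace ℝ (Fin n)) : HasDerivAt (fun t : ℝ => chartForm c (u + t • w) a b)
      (fderiv ℝ (fun u => chartForm c u a b) u w) 0 := by
    have h := (differentiableAt_chartForm_apply hu a b).hasFDerivAt
    rw [← add_zero u, ← zero_smul ℝ w] at h
    simpa using! h.comp_hasDerivAt (0 : ℝ) hline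
  set a' := christoffelMap c u w a
  set b' := christoffelMap c u w b
  have h := (((hq a b).sub ((hasDerivAt_id (0 : ℝ)).mul (hq a' b))).sub
    ((hasDerivAt_id (0 : ℝ)).mul (hq a b'))).add
    ((hasDerivAt_id (0 : ℝ)).mul ((hasDerivAt_id (0 : ℝ)).mul (hq a' b')))
  convert! h using 1
  · funext t
    simp only [Pi.add_apply, Pi.sub_apply, Pi.mul_apply, map_sub, map_smul, sub_apply, smul_apply,
      smul_eq_mul, id]
    ring
  · rw [fderiv_chartForm hu]
    simp [a', b']

end Charts

section CovariantDerivative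

variable {𝕜 : Type*} [RCLike 𝕜] {m n : ℕ} {M : Type*} [TopologicalSpace M]
  [ChartedSpace (EuclideanSpace ℝ (Fin n)) M]
  [RiemannianBundle (fun x : M => TangentSpace (𝓡 n) x)]

/-! ### The covariant derivative -/

theorem inChart_add (f h : TensorField n M 𝕜 m) (c : M) :
    inChart (f + h) c = inChart f c + inChart h c := by
  funext u; ext v; rfl

theorem inChart_smul (k : 𝕜) (f : TensorField n M 𝕜 m) (c : M) :
    inChart (k • f) c = k • inChart f c := by
  funext u; ext v; rfl

theorem IsSmoothSymm.add {f h : TensorField n M 𝕜 m} (hf : IsSmoothSymm f) (hh : IsSmoothSymm h) :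
    IsSmoothSymm (f + h) :=
  ⟨fun x => (hf.symm x).add (hh.symm x), fun c => by
    rw [inChart_add]; exact (hf.smooth c).add (hh.smooth c)⟩

theorem IsSmoothSymm.smul {f : TensorField n M 𝕜 m} (hf : IsSmoothSymm f) (k : 𝕜) :
    IsSmoothSymm (k • f) :=
  ⟨fun x => (hf.symm x).smul k, fun c => by
    rw [inChart_smul]; exact (hf.smooth c).const_smul k⟩

theorem IsSmoothSymm.sub {f h : TensorField n M 𝕜 m} (hf : IsSmoothSymm f) (hh : IsSmoothSymm h) :
    IsSmoothSymm (f - h) := by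
  have : f - h = f + (-1 : 𝕜) • h := by
    funext x; ext v; simp [sub_eq_add_neg]
  rw [this]
  exact hf.add (hh.smul _)

theorem isSmoothSymm_zero : IsSmoothSymm (0 : TensorField n M 𝕜 m) :=
  ⟨fun _ _ _ => rfl, fun c => by
    have : inChart (0 : TensorField n M 𝕜 m) c = fun _ => 0 := by
      funext u; ext v; rfl
    rw [this]
    exact contDiffOn_const⟩

theorem isSymm_inChart {f : TensorField n M 𝕜 m} (hf : ∀ x, IsSymm (f x)) (c : M)
    (u : EuclideanSpace ℝ (Fin n)) : IsSymm (inChart f c u) :=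
  fun s v => hf _ s fun a => coordFrame c u (v a)

theorem inChart_iOp (f : TensorField n M 𝕜 m) (c : M) (u : EuclideanSpace ℝ (Fin n)) :
    inChart (fun x => iOp (f x)) c u = symmetrize (formMul (chartForm c u) (inChart f c u)) := by
  ext v
  rw [inChart_apply, iOp, symmetrize_apply, symmetrize_apply]
  rfl

theorem inChart_iOp_diag (f : TensorField n M 𝕜 m) (c : M) (u z : EuclideanSpace ℝ (Fin n)) :
    inChart (fun x => iOp (f x)) c u (fun _ => z) =
      chartForm c u z z • inChart f c u (fun _ => z) := by
  rw [inChart_iOp, symmetrize_diag, formMul_apply]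

theorem IsSmoothSymm.differentiableAt {f : TensorField n M 𝕜 m} (hf : IsSmoothSymm f) {c : M}
    {u : EuclideanSpace ℝ (Fin n)} (hu : u ∈ (extChartAt (𝓡 n) c).target) :
    DifferentiableAt ℝ (inChart f c) u :=
  ((hf.smooth c).contDiffAt ((isOpen_extChartAt_target c).mem_nhds hu)).differentiableAt (by simp)

/-- The covariant derivative is the derivative along straight lines of the values on vectors
transported by means of the Christoffel symbols. -/
theorem hasDerivAt_inChart {f : TensorField n M 𝕜 m} {c : M} {u : EuclideanSpace ℝ (Fin n)}
    (hf : DifferentiableAt ℝ (inChart f c) u) (w : EuclideanSpace ℝ (Fin n))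
    {z : ℝ → Fin m → EuclideanSpace ℝ (Fin n)} (hz : ∀ a, HasDerivAt (fun t => z t a) 0 0) :
    HasDerivAt (fun t : ℝ => inChart f c (u + t • w)
      (fun a => z t a - t • christoffelMap c u w (z t a))) (nablaInChart f c u w (z 0)) 0 := by
  have hline : HasDerivAt (fun t : ℝ => u + t • w) w 0 := by
    simpa using ((hasDerivAt_id (0 : ℝ)).smul_const w).const_add u
  have h1 : HasDerivAt (fun t : ℝ => inChart f c (u + t • w)) (fderiv ℝ (inChart f c) u w) 0 := by
    have h := hf.hasFDerivAt
    rw [← add_zero u, ← zero_smul ℝ w] at h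
    simpa using! h.comp_hasDerivAt (0 : ℝ) hline
  have h2 (a : Fin m) : HasDerivAt (fun t : ℝ => z t a - t • christoffelMap c u w (z t a))
      (-christoffelMap c u w (z 0 a)) 0 := by
    have h3 := (christoffelMap c u w).hasFDerivAt.comp_hasDerivAt (0 : ℝ) (hz a)
    simpa using! (hz a).sub ((hasDerivAt_id (0 : ℝ)).smul h3)
  have h := (h1.hasFDerivAt.continuousMultilinearMap_apply
    fun a => (h2 a).hasFDerivAt).hasDerivAt
  convert! h using 1
  rw [nablaInChart_apply]
  have hneg (s : Fin m) : inChart f c u (Function.update (fun a => z 0 a) s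
      (-christoffelMap c u w (z 0 s))) =
        -inChart f c u (Function.update (z 0) s (christoffelMap c u w (z 0 s))) :=
    (inChart f c u).toMultilinearMap.map_update_neg _ _ _
  simp [sub_eq_add_neg, hneg]

theorem hasDerivAt_inChart_const {f : TensorField n M 𝕜 m} {c : M} {u : EuclideanSpace ℝ (Fin n)}
    (hf : DifferentiableAt ℝ (inChart f c) u) (w : EuclideanSpace ℝ (Fin n))
    (z : Fin m → EuclideanSpace ℝ (Fin n)) :
    HasDerivAt (fun t : ℝ => inChart f c (u + t • w)
      (fun a => z a - t • christoffelMap c u w (z a))) (nablaInChart f c u w z) 0 :=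
  hasDerivAt_inChart hf w (z := fun _ => z) fun _ => hasDerivAt_const _ _

theorem nabla_curryLeft_apply (f : TensorField n M 𝕜 m) (x : M) (X : TangentSpace (𝓡 n) x)
    (v : Fin m → TangentSpace (𝓡 n) x) :
    (nabla f x).curryLeft X v = nablaInChart f x (extChartAt (𝓡 n) x x) (chartDifferential x X)
      (fun a => chartDifferential x (v a)) := rfl

/-- All arguments are transported by the same rule, so permuting them leaves the differentiated
function unchanged. -/
theorem IsSmoothSymm.isSymm_nabla {f : TensorField n M 𝕜 m} (hf : IsSmoothSymm f) (x : M)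
    (X : TangentSpace (𝓡 n) x) : IsSymm ((nabla f x).curryLeft X) := by
  intro s v
  rw [nabla_curryLeft_apply, nabla_curryLeft_apply]
  have hd := hf.differentiableAt (mem_extChartAt_target (I := 𝓡 n) x)
  have h1 := hasDerivAt_inChart_const hd (chartDifferential x X)
    (fun a => chartDifferential x (v (s a)))
  refine h1.unique ?_
  convert! hasDerivAt_inChart_const hd (chartDifferential x X)
    (fun a => chartDifferential x (v a)) using 1
  funext t
  exact isSymm_inChart hf.symm x _ s fun a => chartDifferential x (v a) - t •
    christoffelMap x (extChartAt (𝓡 n) x x) (chartDifferential x X) (chartDifferential x (v a))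

theorem IsSmoothSymm.nabla_add {f h : TensorField n M 𝕜 m} (hf : IsSmoothSymm f)
    (hh : IsSmoothSymm h) : nabla (f + h) = nabla f + nabla h := by
  funext x; ext v
  have hf' := hf.differentiableAt (mem_extChartAt_target (I := 𝓡 n) x)
  have hh' := hh.differentiableAt (mem_extChartAt_target (I := 𝓡 n) x)
  simp only [nabla_apply, Pi.add_apply, add_apply, nablaInChart_apply, inChart_add]
  rw [fderiv_add hf' hh']
  simp only [Finset.sum_add_distrib, add_apply]
  ring

theorem IsSmoothSymm.nabla_smul {f : TensorField n M 𝕜 m} (hf : IsSmoothSymm f) (k : 𝕜) :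
    nabla (k • f) = k • nabla f := by
  funext x; ext v
  have hf' := hf.differentiableAt (mem_extChartAt_target (I := 𝓡 n) x)
  simp only [nabla_apply, Pi.smul_apply, smul_apply, nablaInChart_apply, inChart_smul]
  rw [fderiv_const_smul hf']
  simp only [smul_apply, smul_eq_mul, ← Finset.mul_sum]
  ring

theorem IsSmoothSymm.dOp_add {f h : TensorField n M 𝕜 m} (hf : IsSmoothSymm f)
    (hh : IsSmoothSymm h) : dOp (f + h) = dOp f + dOp h := by
  funext x
  simp only [dOp, hf.nabla_add hh, Pi.add_apply, symmetrize_add]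

theorem IsSmoothSymm.dOp_smul {f : TensorField n M 𝕜 m} (hf : IsSmoothSymm f) (k : 𝕜) :
    dOp (k • f) = k • dOp f := by
  funext x
  simp only [dOp, hf.nabla_smul k, Pi.smul_apply, symmetrize_smul]

/-! ### Compatibility with the metric -/

theorem inner_centerFrame (x : M) (a b : EuclideanSpace ℝ (Fin n)) :
    inner ℝ (centerFrame x a) (centerFrame x b) = chartForm x (extChartAt (𝓡 n) x x) a b := by
  -- The chart followed by its inverse returns `x` only up to a propositional equality, so the inner
  -- product is moved between fibres by generalizing the base point.
  have key : ∀ y : M, y = x → ∀ a' b' : EuclideanSpace ℝ (Fin n),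
      @inner ℝ (TangentSpace (𝓡 n) x) _ a' b' = @inner ℝ (TangentSpace (𝓡 n) y) _ a' b' := by
    rintro _ rfl _ _
    rfl
  exact key _ (extChartAt_to_inv (I := 𝓡 n) x) _ _

variable [IsManifold (𝓡 n) ∞ M]

theorem TraceZero.jOp_eq_zero {V : Type*} [NormedAddCommGroup V] [InnerProductSpace ℝ V]
    [FiniteDimensional ℝ V] {F : CovTensor 𝕜 (m + 2) V} (h : TraceZero F) : jOp F = 0 := h

variable [IsContMDiffRiemannianBundle (𝓡 n) ∞ (EuclideanSpace ℝ (Fin n))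
      (fun x : M => TangentSpace (𝓡 n) x)]

theorem IsSmoothSymm.iOp {f : TensorField n M 𝕜 m} (hf : IsSmoothSymm f) :
    IsSmoothSymm (fun x => iOp (f x)) := by
  refine ⟨fun x => isSymm_iOp _, fun c => ?_⟩
  rw [show inChart (fun x => KillingTensor.iOp (f x)) c = _ from funext fun u => inChart_iOp f c u]
  exact contDiffOn_symmetrize_formMul (contDiffOn_chartForm c) (hf.smooth c)

/-- Fibrewise algebra yields `v` with no control on its dependence on the point; smoothness is
recovered from that of `iv`. -/
theorem IsSmoothSymm.of_iOp [NeZero n] {f : TensorField n M 𝕜 m} (hf : ∀ x, IsSymm (f x))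
    (h : IsSmoothSymm (fun x => KillingTensor.iOp (f x))) : IsSmoothSymm f := by
  refine ⟨hf, fun c u hu => ContDiffAt.contDiffWithinAt ?_⟩
  have h1 := h.smooth c
  rw [show inChart (fun x => KillingTensor.iOp (f x)) c = _ from
    funext fun u => inChart_iOp f c u] at h1
  exact contDiffAt_of_symmetrize_formMul ((isOpen_extChartAt_target c).mem_nhds hu)
    (contDiffOn_chartForm c) (fun z hz => (chartForm_self_pos hu hz).ne')
    (isSymm_inChart hf c) h1

/-- On the diagonal this is a product rule in which the metric factor `⟨X, X⟩` is stationary along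
transported vectors. -/
theorem IsSmoothSymm.dOp_iOp {f : TensorField n M 𝕜 m} (hf : IsSmoothSymm f) :
    dOp (fun x => KillingTensor.iOp (f x)) = fun x => KillingTensor.iOp (dOp f x) := by
  funext x
  refine (isSymm_symmetrize _).ext_diag (isSymm_iOp _) fun X => ?_
  rw [iOp_diag]
  simp only [dOp, symmetrize_diag, nabla_apply]
  have hu := mem_extChartAt_target (I := 𝓡 n) x
  set w := chartDifferential x X with hw
  have h1 := hasDerivAt_inChart_const (hf.iOp.differentiableAt hu) w (fun _ => w)
  have h2 := (hasDerivAt_chartForm hu w w w).smul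
    (hasDerivAt_inChart_const (hf.differentiableAt hu) w (fun _ => w))
  have h3 : inner ℝ X X = chartForm x (extChartAt (𝓡 n) x x) w w := by
    rw [← inner_centerFrame, hw, centerFrame_chartDifferential]
  rw [h3]
  simp only [inChart_iOp_diag] at h1
  simpa using! h1.unique h2

/-- The trace of the covariant derivative of a trace-free field vanishes in charts. -/
theorem exists_sum_nablaInChart_eq_zero {f : TensorField n M 𝕜 (m + 2)} (hf : IsSmoothSymm f)
    (htr : ∀ x, jOp (f x) = 0) {c : M} {u : EuclideanSpace ℝ (Fin n)}
    (hu : u ∈ (extChartAt (𝓡 n) c).target) (w : EuclideanSpace ℝ (Fin n)) :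
    ∃ H R : EuclideanSpace ℝ (Fin n) →L[ℝ] EuclideanSpace ℝ (Fin n),
      (∀ x y, inner ℝ (H x) y = chartForm c u x y) ∧ (∀ x, R (H x) = x) ∧
      ∀ v, ∑ k, nablaInChart f c u w (Fin.cons (R (EuclideanSpace.basisFun (Fin n) ℝ k))
        (Fin.cons (EuclideanSpace.basisFun (Fin n) ℝ k) v)) = 0 := by
  set e := EuclideanSpace.basisFun (Fin n) ℝ
  -- `A t` is transport to first order, and `H t` is the Gram operator of the transported frame;
  -- metric compatibility makes `H`, hence its inverse, stationary at `t = 0`.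
  let A (t : ℝ) : EuclideanSpace ℝ (Fin n) →L[ℝ] EuclideanSpace ℝ (Fin n) :=
    ContinuousLinearMap.id ℝ _ - t • christoffelMap c u w
  have hA (t : ℝ) (z) : A t z = z - t • christoffelMap c u w z := by simp [A]
  let H (t : ℝ) : EuclideanSpace ℝ (Fin n) →L[ℝ] EuclideanSpace ℝ (Fin n) :=
    gramOperator fun i j => chartForm c (u + t • w) (A t (e i)) (A t (e j))
  have hH (t : ℝ) (x y) : inner ℝ (H t x) y = chartForm c (u + t • w) (A t x) (A t y) :=
    inner_gramOperator ((chartForm c (u + t • w)).bilinearComp (A t) (A t)) x y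
  have hH' : HasDerivAt H 0 0 := by
    have h1 (i j : Fin n) := hasDerivAt_chartForm hu w (e i) (e j)
    simp only [← hA] at h1
    exact hasDerivAt_sum_smul _ h1
  have hH0 (x y) : inner ℝ (H 0 x) y = chartForm c u x y := by
    simpa [hA] using hH 0 x y
  have hunit0 : IsUnit (H 0) := by
    rw [ContinuousLinearMap.isUnit_iff_isUnit_toLinearMap, LinearMap.isUnit_iff_ker_eq_bot,
      LinearMap.ker_eq_bot']
    intro x hx
    by_contra hne
    refine (chartForm_self_pos hu hne).ne' ?_
    rw [← hH0, show H 0 x = 0 from hx, inner_zero_left]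
  have hR' : HasDerivAt (fun t => Ring.inverse (H t)) 0 0 := hasDerivAt_ringInverse_zero hH' hunit0
  refine ⟨H 0, Ring.inverse (H 0), hH0,
    fun x => DFunLike.congr_fun (Ring.inverse_mul_cancel _ hunit0) x, fun v => ?_⟩
  -- The argument `H(t)⁻¹ e_k` varies with `t`, but with zero velocity, so it adds nothing to the
  -- derivative.
  have hq := HasDerivAt.fun_sum (u := Finset.univ) fun k _ => hasDerivAt_inChart
    (hf.differentiableAt hu) w
    (z := fun t => Fin.cons (Ring.inverse (H t) (e k)) (Fin.cons (e k) v)) (by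
      intro a
      refine Fin.cases ?_ (fun a => ?_) a
      · simpa using! hR'.clm_apply (hasDerivAt_const (0 : ℝ) (e k))
      · exact hasDerivAt_const _ _)
  refine hq.unique ((hasDerivAt_const (0 : ℝ) (0 : 𝕜)).congr_of_eventuallyEq ?_)
  -- While `H t` is invertible, the differentiated sum is the trace of `f` in a moving frame, which
  -- is zero.
  have hev1 : ∀ᶠ t : ℝ in nhds 0, IsUnit (H t) :=
    hH'.continuousAt.eventually (Units.isOpen.mem_nhds hunit0)
  filter_upwards [hev1] with t ht
  have h1 := fun v' => jOp_eq_sum_frame (V := TangentSpace (𝓡 n) ((extChartAt (𝓡 n) c).symm (u + t • w)))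
    e rfl (P := ((coordFrame c (u + t • w)).comp (A t)).toLinearMap) (H := (H t).toLinearMap)
    (R := (Ring.inverse (H t)).toLinearMap) (fun x y => hH t x y)
    (fun x => DFunLike.congr_fun (Ring.inverse_mul_cancel _ ht) x) (f _) v'
  simp only [htr, zero_apply] at h1
  rw [← h1 fun a => coordFrame c (u + t • w) (A t (v a))]
  refine Finset.sum_congr rfl fun k _ => ?_
  rw [inChart_apply]
  congr 1
  funext a
  rw [← hA]
  refine Fin.cases rfl (fun a => Fin.cases rfl (fun a => rfl) a) a

/-- The metric is parallel, so `∇_X` commutes with the trace. -/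
theorem IsSmoothTraceFree.nabla_curryLeft_mem {f : TensorField n M 𝕜 m}
    (hf : IsSmoothTraceFree f) (x : M) (X : TangentSpace (𝓡 n) x) :
    (nabla f x).curryLeft X ∈ kerJ 𝕜 m (TangentSpace (𝓡 n) x) := by
  refine ⟨hf.1.isSymm_nabla x X, ?_⟩
  match m, f, hf with
  | 0, _, _ => trivial
  | 1, _, _ => trivial
  | m + 2, f, hf =>
    obtain ⟨H, R, hH, hR, h0⟩ := exists_sum_nablaInChart_eq_zero hf.1
      (fun y => (hf.2 y).jOp_eq_zero) (mem_extChartAt_target (I := 𝓡 n) x) (chartDifferential x X)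
    refine ContinuousMultilinearMap.ext fun v => ?_
    rw [← jOp_eq_sum_frame (V := TangentSpace (𝓡 n) x) (EuclideanSpace.basisFun (Fin n) ℝ) rfl
      (P := (centerFrame x).toLinearMap) (H := H.toLinearMap) (R := R.toLinearMap)
      (fun a b => (hH a b).trans (inner_centerFrame x a b).symm) hR]
    refine Eq.trans (Finset.sum_congr rfl fun k _ => ?_) (h0 fun a => chartDifferential x (v a))
    rw [nabla_curryLeft_apply]
    congr 1
    funext a
    refine Fin.cases (chartDifferential_centerFrame x _)
      (fun a => Fin.cases (chartDifferential_centerFrame x _) (fun a => rfl) a) a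

end CovariantDerivative

section Main

/-! ### Killing tensor fields and their higher harmonics -/

variable {𝕜 : Type*} [RCLike 𝕜] {m n : ℕ} {M : Type*} [TopologicalSpace M]
  [ChartedSpace (EuclideanSpace ℝ (Fin n)) M]

instance [NeZero n] (x : M) : Nontrivial (TangentSpace (𝓡 n) x) :=
  inferInstanceAs (Nontrivial (EuclideanSpace ℝ (Fin n)))

theorem finrank_tangentSpace (x : M) : Module.finrank ℝ (TangentSpace (𝓡 n) x) = n :=
  (finrank_euclideanSpace_fin (𝕜 := ℝ) (n := n))

variable [RiemannianBundle (fun x : M => TangentSpace (𝓡 n) x)]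

theorem TensorField.eq_zero_of_dim_zero (hn : n = 0) (f : TensorField n M 𝕜 (m + 1)) : f = 0 := by
  subst hn
  funext x
  ext v
  exact (f x).map_coord_zero 0 (Subsingleton.elim (α := EuclideanSpace ℝ (Fin 0)) _ _)

theorem divergence_eq_zero_of_dim_zero (hn : n = 0) (f : TensorField n M 𝕜 (m + 1)) :
    divergence f = 0 := by
  funext x
  ext v
  have := finrank_tangentSpace (n := n) x
  have : IsEmpty (Fin (Module.finrank ℝ (TangentSpace (𝓡 n) x))) := by
    rw [this, hn]; infer_instance
  simp [divergence, jOp_apply]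

theorem IsSymm.mem_kerJ_of_lt_two {V : Type*} [NormedAddCommGroup V] [InnerProductSpace ℝ V]
    [FiniteDimensional ℝ V] {F : CovTensor 𝕜 m V} (hF : IsSymm F) (hm : m < 2) :
    F ∈ kerJ 𝕜 m V := by
  refine ⟨hF, ?_⟩
  match m, hm with
  | 0, _ => trivial
  | 1, _ => trivial

theorem higherHarmonic_of_lt_two {f : TensorField n M 𝕜 m} (hf : ∀ x, IsSymm (f x)) (hm : m < 2) :
    higherHarmonic f = f :=
  funext fun x => pOp_of_mem ((hf x).mem_kerJ_of_lt_two hm)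

theorem higherHarmonic_zero : higherHarmonic (0 : TensorField n M 𝕜 m) = 0 :=
  funext fun _ => pOp_of_mem (Submodule.zero_mem _)

theorem IsSmoothTraceFree.higherHarmonic_eq {f : TensorField n M 𝕜 m}
    (hf : IsSmoothTraceFree f) : higherHarmonic f = f :=
  funext fun x => pOp_of_mem ⟨hf.1.symm x, hf.2 x⟩

theorem higherHarmonic_add_iOp {f : TensorField n M 𝕜 (m + 2)} (hf : ∀ x, IsSymm (f x))
    (v : TensorField n M 𝕜 m) :
    higherHarmonic (f + fun x => iOp (v x)) = higherHarmonic f := by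
  funext x
  obtain ⟨w, -, hw⟩ := (hf x).exists_sub_pOp_eq_iOp
  change pOp (f x + iOp (v x)) = pOp (f x)
  have h1 : f x + iOp (v x) = pOp (f x) + iOp (w + v x) := by
    rw [iOp_add, ← hw]
    abel
  rw [h1, pOp_add_iOp (pOp_mem _)]

theorem IsSmoothTraceFree.exists_isKilling_iff_of_lt_two {f : TensorField n M 𝕜 m}
    (hf : IsSmoothTraceFree f) (hm : m < 2) :
    (∃ F : TensorField n M 𝕜 m, IsKilling F ∧ higherHarmonic F = f) ↔ dOp f = 0 := by
  constructor
  · rintro ⟨F, hF, rfl⟩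
    rw [higherHarmonic_of_lt_two hF.1.symm hm]
    exact hF.2
  · exact fun h => ⟨f, ⟨hf.1, h⟩, hf.higherHarmonic_eq⟩

variable [IsManifold (𝓡 n) ∞ M] [IsContMDiffRiemannianBundle (𝓡 n) ∞ (EuclideanSpace ℝ (Fin n))
      (fun x : M => TangentSpace (𝓡 n) x)]

/-- Smooth symmetric fields with the same higher harmonic differ by a smooth multiple of the
metric. -/
theorem IsSmoothSymm.exists_eq_add_iOp [NeZero n] {f h : TensorField n M 𝕜 (m + 2)}
    (hf : IsSmoothSymm f) (hh : IsSmoothSymm h) (heq : higherHarmonic h = higherHarmonic f) :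
    ∃ v : TensorField n M 𝕜 m, IsSmoothSymm v ∧ h = f + fun x => KillingTensor.iOp (v x) := by
  choose v₁ hv₁ h₁ using fun x => (hh.symm x).exists_sub_pOp_eq_iOp
  choose v₂ hv₂ h₂ using fun x => (hf.symm x).exists_sub_pOp_eq_iOp
  have key : (fun x => KillingTensor.iOp (v₁ x - v₂ x)) = h - f := by
    funext x
    have hp : pOp (h x) = pOp (f x) := congrFun heq x
    rw [iOp_sub, ← h₁, ← h₂, hp, Pi.sub_apply]
    abel
  refine ⟨fun x => v₁ x - v₂ x, IsSmoothSymm.of_iOp (fun x => (hv₁ x).sub (hv₂ x)) ?_, ?_⟩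
  · rw [key]
    exact hh.sub hf
  · rw [key, add_sub_cancel]

theorem IsSmoothSymm.dOp_add_iOp {f : TensorField n M 𝕜 (m + 2)} (hf : IsSmoothSymm f)
    {v : TensorField n M 𝕜 m} (hv : IsSmoothSymm v) :
    dOp (f + fun x => KillingTensor.iOp (v x)) =
      dOp f + fun x => KillingTensor.iOp (dOp v x) := by
  rw [hf.dOp_add hv.iOp, hv.dOp_iOp]

theorem isKilling_and_higherHarmonic_eq_iff {f : TensorField n M 𝕜 m} (hf : IsKilling f)
    (h : TensorField n M 𝕜 m) :
    (IsKilling h ∧ higherHarmonic h = higherHarmonic f) ↔ IsMetricTimesKilling (h - f) := by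
  have low (hm : m < 2) :
      (IsKilling h ∧ higherHarmonic h = higherHarmonic f) ↔ h - f = 0 := by
    rw [sub_eq_zero]
    constructor
    · rintro ⟨hh, heq⟩
      rwa [higherHarmonic_of_lt_two hh.1.symm hm, higherHarmonic_of_lt_two hf.1.symm hm] at heq
    · rintro rfl
      exact ⟨hf, rfl⟩
  match m, f, hf, h, low with
  | 0, _, _, _, low => exact low (by norm_num)
  | 1, _, _, _, low => exact low (by norm_num)
  | m + 2, f, hf, h, _ =>
    constructor
    · rintro ⟨hh, heq⟩
      rcases eq_or_ne n 0 with hn | hn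
      · have hd : dOp (0 : TensorField n M 𝕜 m) = 0 := TensorField.eq_zero_of_dim_zero hn _
        exact ⟨0, ⟨isSmoothSymm_zero, hd⟩, (TensorField.eq_zero_of_dim_zero hn _).trans
          (TensorField.eq_zero_of_dim_zero hn _).symm⟩
      · have : NeZero n := ⟨hn⟩
        obtain ⟨v, hv, rfl⟩ := hf.1.exists_eq_add_iOp hh.1 heq
        refine ⟨v, ⟨hv, funext fun x => ?_⟩, add_sub_cancel_left _ _⟩
        have h0 := hh.2
        rw [hf.1.dOp_add_iOp hv, hf.2, zero_add] at h0
        -- Applying `d` to `h = f + iv` leaves `i(dv) = 0`, and `i` is injective.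
        exact (isSymm_symmetrize _).eq_zero_of_iOp_eq_zero (congrFun h0 x)
    · rintro ⟨v, hv, hvh⟩
      obtain rfl : h = f + fun x => iOp (v x) := by rw [← hvh, add_sub_cancel]
      refine ⟨⟨hf.1.add hv.1.iOp, ?_⟩, higherHarmonic_add_iOp hf.1.symm v⟩
      rw [hf.1.dOp_add_iOp hv.1, hf.2, hv.2, zero_add]
      funext x
      exact iOp_zero

/-- For a trace-free field `f`, the condition `pdf = 0` means that `df` is a specific multiple
of `iδf`. -/
theorem IsSmoothTraceFree.exists_higherHarmonic_dOp_eq_zero_iff [NeZero n]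
    {f : TensorField n M 𝕜 (m + 1)} (hf : IsSmoothTraceFree f) :
    ∃ k : 𝕜, k ≠ 0 ∧
      (higherHarmonic (dOp f) = 0 ↔ dOp f = fun x => iOp (k • divergence f x)) := by
  have hn : n ≠ 0 := NeZero.ne n
  refine ⟨((m : 𝕜) + 1) / ((n : 𝕜) + 2 * m), div_ne_zero (by exact_mod_cast m.succ_ne_zero)
    (by exact_mod_cast (by lia : n + 2 * m ≠ 0)), ?_⟩
  rw [funext_iff, funext_iff]
  refine forall_congr' fun x => ?_
  have h := pOp_symmetrize_eq_zero_iff (hf.nabla_curryLeft_mem x)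
  rw [finrank_tangentSpace] at h
  exact h

theorem IsSmoothTraceFree.isSymm_divergence {f : TensorField n M 𝕜 (m + 1)}
    (hf : IsSmoothTraceFree f) (x : M) : IsSymm (divergence f x) :=
  (jOp_mem_kerJ (hf.nabla_curryLeft_mem x)).1

/-- In rank 1 there is no correction `iv`. Once `df = i(kδf)` with `k ≠ 0`, injectivity of `i` makes
`df = 0` equivalent to `δf = 0`. -/
theorem IsSmoothTraceFree.dOp_eq_zero_iff [NeZero n] {f : TensorField n M 𝕜 1}
    (hf : IsSmoothTraceFree f) :
    dOp f = 0 ↔ higherHarmonic (dOp f) = 0 ∧ divergence f = 0 := by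
  obtain ⟨k, hk0, hiff⟩ := hf.exists_higherHarmonic_dOp_eq_zero_iff
  constructor
  · intro h
    have hpd : higherHarmonic (dOp f) = 0 := by rw [h, higherHarmonic_zero]
    refine ⟨hpd, funext fun x => ?_⟩
    have h0 : iOp (k • divergence f x) = 0 :=
      (congrFun (hiff.1 hpd) x).symm.trans (congrFun h x)
    have h1 := ((hf.isSymm_divergence x).smul k).eq_zero_of_iOp_eq_zero h0
    exact (smul_eq_zero.1 h1).resolve_left hk0
  · rintro ⟨hpd, h0⟩
    rw [hiff.1 hpd]
    funext x
    rw [h0, iOp_smul, Pi.zero_apply, iOp_zero]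
    ext v
    exact mul_zero k

theorem IsSmoothTraceFree.exists_isKilling_iff_of_two_le [NeZero n]
    {f : TensorField n M 𝕜 (m + 2)} (hf : IsSmoothTraceFree f) :
    (∃ F : TensorField n M 𝕜 (m + 2), IsKilling F ∧ higherHarmonic F = f) ↔
      higherHarmonic (dOp f) = 0 ∧
        ∃ v : TensorField n M 𝕜 m, IsSmoothSymm v ∧ divergence f = dOp v := by
  obtain ⟨k, hk0, hiff⟩ := hf.exists_higherHarmonic_dOp_eq_zero_iff
  constructor
  · rintro ⟨F, hF, hFf⟩
    obtain ⟨v, hv, rfl⟩ := hf.1.exists_eq_add_iOp hF.1 (by rw [hFf, hf.higherHarmonic_eq])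
    have h0 := hF.2
    rw [hf.1.dOp_add_iOp hv] at h0
    have h1 (x : M) : dOp f x = iOp (-dOp v x) := by
      rw [← zero_sub, iOp_sub, iOp_zero, zero_sub]
      exact eq_neg_of_add_eq_zero_left (congrFun h0 x)
    have hpd : higherHarmonic (dOp f) = 0 := by
      funext x
      change pOp (dOp f x) = 0
      rw [h1, ← zero_add (iOp _), pOp_add_iOp (Submodule.zero_mem _)]
    -- Comparing `df = -i(dv)` with `df = i(kδf)` gives `kδf + dv = 0`.
    refine ⟨hpd, (-k⁻¹) • v, hv.smul _, ?_⟩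
    rw [hv.dOp_smul]
    funext x
    have h2 : iOp (k • divergence f x + dOp v x) = 0 := by
      rw [← sub_neg_eq_add, iOp_sub, ← h1 x, sub_eq_zero]
      exact (congrFun (hiff.1 hpd) x).symm
    have h3 := (((hf.isSymm_divergence x).smul k).add
      (isSymm_symmetrize _)).eq_zero_of_iOp_eq_zero h2
    ext z
    have h4 : k * divergence f x z + dOp v x z = 0 := DFunLike.congr_fun h3 z
    change divergence f x z = -k⁻¹ * dOp v x z
    rw [eq_neg_of_add_eq_zero_right h4, neg_mul_neg, inv_mul_cancel_left₀ hk0]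
  · rintro ⟨hpd, v, hv, hδv⟩
    -- The correction `-k v` is chosen so that `i(d(-kv))` cancels `df = i(kδf) = i(k dv)`.
    refine ⟨f + fun x => iOp (((-k) • v) x), ⟨hf.1.add (hv.smul _).iOp, ?_⟩, ?_⟩
    · rw [hf.1.dOp_add_iOp (hv.smul _), hiff.1 hpd, hv.dOp_smul, hδv]
      funext x
      change iOp (k • dOp v x) + iOp ((-k) • dOp v x) = 0
      rw [iOp_smul, iOp_smul]
      ext z
      change k * iOp (dOp v x) z + -k * iOp (dOp v x) z = 0
      ring
    · rw [higherHarmonic_add_iOp hf.1.symm, hf.higherHarmonic_eq]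

theorem IsSmoothTraceFree.exists_isKilling_iff {f : TensorField n M 𝕜 m}
    (hf : IsSmoothTraceFree f) :
    (∃ F : TensorField n M 𝕜 m, IsKilling F ∧ higherHarmonic F = f) ↔
      higherHarmonic (dOp f) = 0 ∧ HasPotentialDivergence f := by
  match m, f, hf with
  | 0, f, hf =>
    rw [hf.exists_isKilling_iff_of_lt_two (by norm_num),
      higherHarmonic_of_lt_two (f := dOp f) (fun x => isSymm_symmetrize _) (by norm_num)]
    exact (and_iff_left trivial).symm
  | m + 1, f, hf =>
    -- In dimension zero all tensors of positive rank vanish and so does every divergence, so both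
    -- sides hold trivially.
    rcases eq_or_ne n 0 with hn | hn
    · refine iff_of_true ⟨f, ⟨hf.1, TensorField.eq_zero_of_dim_zero hn _⟩, hf.higherHarmonic_eq⟩
        ⟨TensorField.eq_zero_of_dim_zero hn _, ?_⟩
      change IsPotential (divergence f)
      rw [divergence_eq_zero_of_dim_zero hn]
      cases m with
      | zero => rfl
      | succ m => exact ⟨0, isSmoothSymm_zero, (TensorField.eq_zero_of_dim_zero hn _).symm⟩
    · have : NeZero n := ⟨hn⟩
      cases m with
      | zero => exact (hf.exists_isKilling_iff_of_lt_two (by norm_num)).trans hf.dOp_eq_zero_iff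
      | succ m => exact hf.exists_isKilling_iff_of_two_le

end Main

end KillingTensor

end

open KillingTensor in
theorem mainTheorem2 {𝕜 : Type*} [RCLike 𝕜] {n : ℕ} {M : Type*} [TopologicalSpace M]
    [T2Space M] [CompactSpace M] [ChartedSpace (EuclideanSpace ℝ (Fin n)) M]
    [IsManifold (𝓡 n) ∞ M] [RiemannianBundle (fun x : M => TangentSpace (𝓡 n) x)]
    [IsContMDiffRiemannianBundle (𝓡 n) ∞ (EuclideanSpace ℝ (Fin n))
      (fun x : M => TangentSpace (𝓡 n) x)] (m : ℕ) :
    (∀ f h : TensorField n M 𝕜 m, IsKilling f →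
      ((IsKilling h ∧ higherHarmonic h = higherHarmonic f) ↔ IsMetricTimesKilling (h - f))) ∧
    (∀ f : TensorField n M 𝕜 m, IsSmoothTraceFree f →
      ((∃ F : TensorField n M 𝕜 m, IsKilling F ∧ higherHarmonic F = f) ↔
        higherHarmonic (dOp f) = 0 ∧ HasPotentialDivergence f)) :=
  ⟨fun _ h hf => isKilling_and_higherHarmonic_eq_iff hf h, fun _ hf => hf.exists_isKilling_iff⟩
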